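/- **Theorem (Karp; the Stitch algorithm).** Let $p_1,\dots,p_n$ be points of the unit square $[0,1]^2$. A tour of a finite set of points visits each of them exactly once and returns to its start; its length is the sum of the Euclidean lengths of its edges. The *Stitch algorithm* works as follows. 1. Divide the unit square evenly into $m\times m$ subsquares, where $m$ is $\sqrt{n/\ln n}$ rounded up or down to an integer (so there are about $n/\ln n$ subsquares, each with side length about $\sqrt{(\ln n)/n}$). Let $P_c$ be the set of input points in subsquare $c$ (points on common boundaries are assigned to one of the adjacent subsquares by a fixed rule). 2. For each subsquare $c$: if $|P_c|\le 6\log_2 n$, compute a tour $T_c$ of $P_c$ of minimum length; otherwise let $T_c$ be an arbitrary tour of $P_c$. 3. Choose an arbitrary representative point in each nonempty $P_c$. Let $T_0$ be the tour of the representatives that visits them from left to right in the bottommost row of subsquares, from right to left in the second row from the bottom, and so on, returning to the starting point after the topmost row. 4. Take a closed Eulerian walk of the multigraph formed by the union of $T_0$ and all the $T_c$ (a walk using each of its edges exactly once), shortcut it to a tour $T$ of all $n$ points by skipping repeated visits, and return $T$. For every $\varepsilon>0$, if $p_1,\dots,p_n$ are drawn independently and uniformly from the unit square, then with probability $1-o(1)$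 as $n\to\infty$ the Stitch algorithm returns a tour, and (however its arbitrary choices are made) the total length of this tour is less than $(1+\varepsilon)$ times that of an optimal tour of $p_1,\dots,p_n$. -/

import Mathlib

noncomputable section

namespace Stitch

/-- The Euclidean plane. -/
abbrev Plane : Type := EuclideanSpace ℝ (Fin 2)

/-- The unit square `[0,1] × [0,1]`. -/
def unitSquare : Set Plane := {x | ∀ i, x i ∈ Set.Icc (0 : ℝ) 1}

/-- The uniform distribution on the unit square: normalized Lebesgue measure. -/
def uniformSquare : MeasureTheory.Measure Plane :=
  ProbabilityTheory.cond MeasureTheory.volume unitSquare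

/-- The joint law of `n` independent uniform points of the unit square. -/
def uniformPoints (n : ℕ) : MeasureTheory.Measure (Fin n → Plane) :=
  MeasureTheory.Measure.pi fun _ => uniformSquare

/-- A closed walk is given by its cyclic list of vertices `[v₁, …, v_k]`. These are its edges
`v₁v₂, …, v_{k-1}v_k, v_kv₁`, with multiplicity. A one-vertex walk has a single loop
(of length `0`), a two-vertex walk uses the same edge twice. -/
def closedEdges {α : Type*} (l : List α) : Multiset (Sym2 α) :=
  ((List.zipWith (fun a b => s(a, b)) l (l.rotate 1) : List (Sym2 α)) : Multiset (Sym2 α))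

/-- The Euclidean length of the closed walk `l` through points labelled by `p`,
including the return to the start. -/
def walkLength {n : ℕ} (p : Fin n → Plane) (l : List (Fin n)) : ℝ :=
  (List.zipWith (fun a b => dist (p a) (p b)) l (l.rotate 1)).sum

/-- `T` is a tour of the (points labelled by) `S`: each is visited exactly once. -/
def IsTour {n : ℕ} (S : Finset (Fin n)) (T : List (Fin n)) : Prop :=
  T.Nodup ∧ ∀ v, v ∈ T ↔ v ∈ S

/-- `T` is a tour of `S` of minimum length. -/
def IsOptimalTour {n : ℕ} (p : Fin n → Plane) (S : Finset (Fin n)) (T : List (Fin n)) : Prop :=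
  IsTour S T ∧ ∀ T', IsTour S T' → walkLength p T ≤ walkLength p T'

/-- The (column, row) of the subsquare containing `x` when the unit square is divided into
`m × m` subsquares of side `1 / m`. Common boundaries are assigned to the subsquare to the right
or above; the right and top sides of the unit square belong to the last column and row. -/
def cellOf (m : ℕ) (x : Plane) : ℕ × ℕ :=
  (min ⌊(m : ℝ) * x 0⌋₊ (m - 1), min ⌊(m : ℝ) * x 1⌋₊ (m - 1))

/-- The `m ^ 2` subsquares. -/
def cells (m : ℕ) : Finset (ℕ × ℕ) := Finset.range m ×ˢ Finset.range m

/-- The set `P_c` of the (labels of) input points in the subsquare `c`. -/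
def pointsIn {n : ℕ} (m : ℕ) (p : Fin n → Plane) (c : ℕ × ℕ) : Finset (Fin n) :=
  Finset.univ.filter fun v => cellOf m (p v) = c

/-- The subsquares in boustrophedon order: the bottom row from left to right, the second row
from right to left, and so on up to the top row. -/
def boustrophedon (m : ℕ) : List (ℕ × ℕ) :=
  (List.range m).flatMap fun j =>
    (if Even j then List.range m else (List.range m).reverse).map fun i => (i, j)

/-- `T₀` consists of exactly one (arbitrary) representative of each nonempty subsquare,
in the boustrophedon order of the subsquares. -/
def IsRepresentativeTour {n : ℕ} (m : ℕ) (p : Fin n → Plane) (T₀ : List (Fin n)) : Prop :=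
  T₀.map (fun v => cellOf m (p v)) =
    (boustrophedon m).filter fun c => decide (pointsIn m p c).Nonempty

/-- `T c` is a tour that the algorithm may use in the subsquare `c`: an optimal tour if there are
at most `6 log₂ n` points in `c`, and an arbitrary tour otherwise. -/
def IsSubtour {n : ℕ} (m : ℕ) (p : Fin n → Plane) (c : ℕ × ℕ) (T : List (Fin n)) : Prop :=
  IsTour (pointsIn m p c) T ∧
    (((pointsIn m p c).card : ℝ) ≤ 6 * Real.logb 2 n → IsOptimalTour p (pointsIn m p c) T)

/-- `T` is a possible output of the Stitch algorithm on the input `p`, run with an `m × m`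
dissection. There are subtours `sub c` of all subsquares and a tour `T₀` of representatives, and
a closed Eulerian walk `w` in the multigraph formed by the union of all these tours, such that
`T` is a tour of all points that results from `w` by skipping repeated visits. -/
def IsStitchOutput {n : ℕ} (m : ℕ) (p : Fin n → Plane) (T : List (Fin n)) : Prop :=
  ∃ (sub : ℕ × ℕ → List (Fin n)) (T₀ w : List (Fin n)),
    (∀ c ∈ cells m, IsSubtour m p c (sub c)) ∧
    IsRepresentativeTour m p T₀ ∧
    closedEdges w = closedEdges T₀ + ∑ c ∈ cells m, closedEdges (sub c) ∧
    T.Sublist w ∧ IsTour Finset.univ T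

/-- On the input `p`, Stitch returns a tour (some run exists), and whatever arbitrary choices it
makes, the tour it returns has length less than `1 + ε` times that of an optimal tour. -/
def StitchSucceeds {n : ℕ} (m : ℕ) (ε : ℝ) (p : Fin n → Plane) : Prop :=
  (∃ T, IsStitchOutput m p T) ∧
    ∀ T Topt, IsStitchOutput m p T → IsOptimalTour p Finset.univ Topt →
      walkLength p T < (1 + ε) * walkLength p Topt

end Stitch

end

/-! The proof has a deterministic half and a probabilistic half. Deterministically, if no subsquare
holds more than `6 log₂ n` points, the output exceeds the optimum by at most `15 * m`. The Eulerian
walk is as long as `T₀` and all subtours together, and shortcutting does not lengthen it. `T₀` has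
length at most `7 * m` (`walkLength_representativeTour_le`). The remaining `8 * m` is Karp's cutting
argument: a tour of all points is cut along the grid lines. A closed walk cut along a segment of
length `s` falls into pieces with endpoints on the segment, and the pieces on each side can be
joined to a closed walk by adding at most `2 * s` of travel along the segment
(`exists_closed_of_pieces`, `exists_cut`). Cutting into columns, and each column into subsquares,
gives a closed walk through the points of each subsquare (`HasClosedWalk.subsquares`); shortcutting
it bounds the optimal subtour there (`sum_walkLength_subtours_le`).

Probabilistically, a Chernoff bound and a union bound exclude crowded subsquares
(`uniformPoints_crowded_le`). It remains to see that `15 * m` is less than `ε` times the optimum. If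
fewer than `n / 2` ordered pairs of points are closer than `r`, every tour is longer than `r * n /
2` (`le_walkLength`). The expected number of such pairs is at most `π r² n²`, so with `r = 30 m / (ε
n)` Markov's inequality bounds the failure probability by `O(m² / n) = O(1 / log n)` for fixed `ε`.
This first-moment estimate replaces the sharper lower bound of order `√n` for the optimum. -/

namespace Stitch

/-! ### Sums over the edges of a walk -/

section PathSum

variable {α β M : Type*} [AddCommMonoid M]

/-- The sum of `f` over the edges of the walk from `a` through the vertices of `l` to `b`. -/
def pathSum (f : α → α → M) : α → List α → α → M
  | a, [], b => f a b
  | a, x :: l, b => f a x + pathSum f x l b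

@[simp] theorem pathSum_nil (f : α → α → M) (a b : α) : pathSum f a [] b = f a b := rfl

@[simp] theorem pathSum_cons (f : α → α → M) (a x : α) (l : List α) (b : α) :
    pathSum f a (x :: l) b = f a x + pathSum f x l b := rfl

theorem pathSum_append (f : α → α → M) (a : α) (l : List α) (x : α) (l' : List α) (b : α) :
    pathSum f a (l ++ x :: l') b = pathSum f a l x + pathSum f x l' b := by
  induction l generalizing a with
  | nil => rfl
  | cons y l ih => simp [ih, add_assoc]

theorem pathSum_reverse (f : α → α → M) (hf : ∀ a b, f a b = f b a) (a : α) (l : List α) (b : α) :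
    pathSum f a l.reverse b = pathSum f b l a := by
  induction l generalizing b with
  | nil => exact hf a b
  | cons x l ih => simp [pathSum_append, ih, hf b x, add_comm]

theorem pathSum_map (f : β → β → M) (g : α → β) (a : α) (l : List α) (b : α) :
    pathSum f (g a) (l.map g) (g b) = pathSum (fun x y => f (g x) (g y)) a l b := by
  induction l generalizing a with
  | nil => rfl
  | cons x l ih => simp [ih]

theorem sum_zipWith_concat (f : α → α → M) (a : α) (l : List α) (b : α) :
    (List.zipWith f (a :: l) (l ++ [b])).sum = pathSum f a l b := by
  induction l generalizing a with
  | nil => simp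
  | cons x l ih => simpa using congrArg (f a x + ·) (ih x)

theorem sum_zipWith_rotate (f : α → α → M) (a : α) (l : List α) :
    (List.zipWith f (a :: l) ((a :: l).rotate 1)).sum = pathSum f a l a := by
  rw [List.rotate_cons_succ, List.rotate_zero, sum_zipWith_concat]

end PathSum

theorem walkLength_cons {n : ℕ} (p : Fin n → Plane) (a : Fin n) (l : List (Fin n)) :
    walkLength p (a :: l) = pathSum dist (p a) (l.map p) (p a) := by
  rw [pathSum_map, walkLength, sum_zipWith_rotate]

theorem closedEdges_nil {α : Type*} : closedEdges ([] : List α) = 0 := rfl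

theorem closedEdges_cons {α : Type*} (a : α) (l : List α) :
    closedEdges (a :: l) = pathSum (fun x y => ({s(x, y)} : Multiset (Sym2 α))) a l a := by
  rw [← sum_zipWith_rotate, closedEdges]
  generalize (a :: l).rotate 1 = l'
  generalize a :: l = l
  induction l generalizing l' with
  | nil => simp
  | cons x l ih => cases l' with
    | nil => simp
    | cons y l' => rw [List.zipWith_cons_cons, List.zipWith_cons_cons, List.sum_cons, ← ih]; rfl

/-- Length depends only on the multiset of edges, which is all that the Eulerian condition controls.
-/
theorem walkLength_eq_sum_closedEdges {n : ℕ} (p : Fin n → Plane) (l : List (Fin n)) :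
    walkLength p l = ((closedEdges l).map
      (Sym2.lift ⟨fun a b => dist (p a) (p b), fun _ _ => dist_comm _ _⟩)).sum := by
  simp [walkLength, closedEdges, List.map_zipWith]

/-! ### Shortcutting by the triangle inequality -/

section Metric

variable {X : Type*} [PseudoMetricSpace X]

theorem pathSum_dist_nonneg (a : X) (l : List X) (b : X) : 0 ≤ pathSum dist a l b := by
  induction l generalizing a with
  | nil => exact dist_nonneg
  | cons x l ih => exact add_nonneg dist_nonneg (ih x)

theorem pathSum_dist_le_start (a x : X) (l : List X) (b : X) :
    pathSum dist a l b ≤ dist a x + pathSum dist x l b := by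
  cases l with
  | nil => exact dist_triangle a x b
  | cons y l =>
    have := dist_triangle a x y
    simp only [pathSum_cons]; linarith

theorem pathSum_dist_le_end (a : X) (l : List X) (x b : X) :
    pathSum dist a l b ≤ pathSum dist a l x + dist x b := by
  have := pathSum_dist_le_start b x l.reverse a
  rwa [pathSum_reverse _ dist_comm, pathSum_reverse _ dist_comm, dist_comm, add_comm] at this

theorem pathSum_dist_sublist {l' l : List X} (h : l'.Sublist l) (a b : X) :
    pathSum dist a l' b ≤ pathSum dist a l b := by
  induction h generalizing a with
  | slnil => exact le_rfl
  | cons x _ ih => exact (pathSum_dist_le_start a x _ b).trans (add_le_add_right (ih x) _)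
  | cons_cons x _ ih => exact add_le_add_right (ih x) _

theorem closed_le_pathSum (x a : X) (l : List X) :
    pathSum dist a l a ≤ pathSum dist x (a :: l) x := by
  have := pathSum_dist_le_end a l x a
  rw [pathSum_cons]; linarith [dist_comm x a]

/-- Points sitting at the vertices of a path can be visited along the path at no extra cost. -/
theorem exists_tour_pathSum_le {n : ℕ} (p : Fin n → X) (l : List X) (a b : X)
    (S : Finset (Fin n)) (hS : ∀ v ∈ S, p v ∈ l) :
    ∃ T, IsTour S T ∧ pathSum dist a (T.map p) b ≤ pathSum dist a l b := by
  classical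
  induction l generalizing a S with
  | nil =>
    refine ⟨[], ⟨List.nodup_nil, fun v => ⟨fun h => by simp at h, fun h => ?_⟩⟩, le_rfl⟩
    simpa using hS v h
  | cons x l ih =>
    -- Several labels may carry the same point. All labels at `x` are listed here, at mutual
    -- distance `0`, and only the others are left to the rest of the path.
    obtain ⟨T, ⟨hT, hmem⟩, hle⟩ := ih x (S.filter fun v => p v ≠ x) fun v hv => by
      rw [Finset.mem_filter] at hv
      exact (List.mem_cons.1 (hS v hv.1)).resolve_left hv.2
    refine ⟨(S.filter fun v => p v = x).toList ++ T, ⟨?_, fun v => ?_⟩, ?_⟩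
    · refine (Finset.nodup_toList _).append hT fun v hv hv' => ?_
      rw [Finset.mem_toList, Finset.mem_filter] at hv
      exact (Finset.mem_filter.1 ((hmem v).1 hv')).2 hv.2
    · rw [List.mem_append, hmem, Finset.mem_toList, Finset.mem_filter, Finset.mem_filter]
      tauto
    · have key : ∀ (L : List (Fin n)), (∀ v ∈ L, p v = x) → ∀ a,
          pathSum dist a ((L ++ T).map p) b ≤ dist a x + pathSum dist x (T.map p) b := by
        intro L
        induction L with
        | nil => exact fun _ a => pathSum_dist_le_start a x _ b
        | cons v L ihL =>
          intro h a
          have h1 := ihL (fun w hw => h w (List.mem_cons_of_mem _ hw)) x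
          rw [dist_self, zero_add] at h1
          simp only [List.cons_append, List.map_cons, pathSum_cons, h v List.mem_cons_self]
          linarith
      refine (key _ (fun v hv => ?_) a).trans (add_le_add_right hle _)
      rw [Finset.mem_toList, Finset.mem_filter] at hv
      exact hv.2

end Metric

theorem walkLength_le_pathSum {n : ℕ} (p : Fin n → Plane) (x : Plane) (l : List (Fin n)) :
    walkLength p l ≤ pathSum dist x (l.map p) x := by
  cases l with
  | nil => simp [walkLength]
  | cons a l => rw [walkLength_cons]; exact closed_le_pathSum x _ _

/-- Skipping vertices does not make a closed walk longer. -/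
theorem walkLength_sublist {n : ℕ} (p : Fin n → Plane) {T w : List (Fin n)} (h : T.Sublist w) :
    walkLength p T ≤ walkLength p w := by
  cases h with
  | slnil => exact le_rfl
  | @cons _ l a h =>
    rw [walkLength_cons p a l]
    exact (walkLength_le_pathSum p (p a) T).trans (pathSum_dist_sublist (h.map p) _ _)
  | cons_cons a h =>
    rw [walkLength_cons, walkLength_cons]
    exact pathSum_dist_sublist (h.map p) _ _

/-! ### Joining pieces with endpoints on a segment -/

section Join

variable {X : Type*}

/-- The vertices of a piece, endpoints included. -/
def OnPiece (x : X) (c : X × List X × X) : Prop := x = c.1 ∨ x ∈ c.2.1 ∨ x = c.2.2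

/-- Both endpoints of the piece are in `E`, and have `g`-coordinates between `A` and `B`. -/
def EndsIn (E : X → Prop) (g : X → ℝ) (A B : ℝ) (c : X × List X × X) : Prop :=
  (E c.1 ∧ A ≤ g c.1 ∧ g c.1 ≤ B) ∧ E c.2.2 ∧ A ≤ g c.2.2 ∧ g c.2.2 ≤ B

theorem EndsIn.mono {E : X → Prop} {g : X → ℝ} {A A' B : ℝ} {c : X × List X × X}
    (h : EndsIn E g A B c) (h1 : A' ≤ g c.1) (h2 : A' ≤ g c.2.2) : EndsIn E g A' B c :=
  ⟨⟨h.1.1, h1, h.1.2.2⟩, h.2.1, h2, h.2.2.2⟩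

variable [PseudoMetricSpace X]

/-- The length of a piece `(u, l, v)`, the path from `u` through `l` to `v`. -/
def pieceLength (c : X × List X × X) : ℝ := pathSum dist c.1 c.2.1 c.2.2

/-- Up to reversal of a piece, some piece starts at the least of all endpoints. -/
theorem exists_least_piece (E : X → Prop) (g : X → ℝ) (A B : ℝ) (P : List (X × List X × X))
    (hne : P ≠ []) (hP : ∀ c ∈ P, EndsIn E g A B c) :
    ∃ (u : X) (l : List X) (v : X) (R : List (X × List X × X)), R.length + 1 = P.length ∧
      (P.map pieceLength).sum = pathSum dist u l v + (R.map pieceLength).sum ∧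
      (∀ y, (∃ c ∈ P, OnPiece y c) ↔ OnPiece y (u, l, v) ∨ ∃ c ∈ R, OnPiece y c) ∧
      A ≤ g u ∧ EndsIn E g (g u) B (u, l, v) ∧ ∀ c ∈ R, EndsIn E g (g u) B c := by
  classical
  obtain ⟨c, hc, hmin⟩ := P.toFinset.exists_min_image (fun c => min (g c.1) (g c.2.2))
    (by simpa [Finset.nonempty_iff_ne_empty] using hne)
  rw [List.mem_toFinset] at hc
  simp only [List.mem_toFinset] at hmin
  have hperm := List.perm_cons_erase hc
  have hlen := hperm.length_eq
  have hsum := (hperm.map pieceLength).sum_eq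
  have hon : ∀ y, (∃ c ∈ P, OnPiece y c) ↔ OnPiece y c ∨ ∃ d ∈ P.erase c, OnPiece y d := fun y => by
    simp only [hperm.mem_iff, List.mem_cons, exists_eq_or_imp]
  have hend : ∀ t, t ≤ min (g c.1) (g c.2.2) → ∀ d ∈ P, EndsIn E g t B d := fun t ht d hd =>
    (hP d hd).mono (ht.trans ((hmin d hd).trans (min_le_left _ _)))
      (ht.trans ((hmin d hd).trans (min_le_right _ _)))
  rw [List.length_cons] at hlen
  rw [List.map_cons, List.sum_cons] at hsum
  rcases le_total (g c.1) (g c.2.2) with h | h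
  · have h' := hend (g c.1) (le_min le_rfl h)
    exact ⟨c.1, c.2.1, c.2.2, P.erase c, hlen.symm, hsum, hon, (hP c hc).1.2.1, h' c hc,
      fun d hd => h' d (List.mem_of_mem_erase hd)⟩
  · have h' := hend (g c.2.2) (le_min h le_rfl)
    refine ⟨c.2.2, c.2.1.reverse, c.1, P.erase c, hlen.symm, ?_, fun y => ?_, (hP c hc).2.2.1,
      ⟨(h' c hc).2, (h' c hc).1⟩, fun d hd => h' d (List.mem_of_mem_erase hd)⟩
    · rw [hsum, pathSum_reverse _ dist_comm]; rfl
    · rw [hon]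
      refine or_congr_left ?_
      simp only [OnPiece, List.mem_reverse]
      generalize (y = c.1) = q₁, (y = c.2.2) = q₂
      tauto

/-- Pieces whose endpoints lie on a segment can be joined to a closed walk at an additional cost of
at most twice the length of the segment. -/
theorem exists_closed_of_pieces (E : X → Prop) (g : X → ℝ)
    (hE : ∀ u v, E u → E v → dist u v ≤ |g u - g v|) (B : ℝ) (k : ℕ) :
    ∀ (A : ℝ) (P : List (X × List X × X)), P.length = k + 1 → (∀ c ∈ P, EndsIn E g A B c) →
    ∃ x l, pathSum dist x l x ≤ (P.map pieceLength).sum + 2 * (B - A) ∧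
      ∀ y, y ∈ x :: l ↔ ∃ c ∈ P, OnPiece y c := by
  induction k with
  | zero =>
    intro A P hlen hP
    obtain ⟨u, l, v, R, hR, hsum, hon, hA, hc, -⟩ := exists_least_piece E g A B P
      (by rintro rfl; simp at hlen) hP
    obtain rfl : R = [] := List.length_eq_zero_iff.1 (by omega)
    refine ⟨u, l ++ [v], ?_, fun y => ?_⟩
    · have h := hE v u hc.2.1 hc.1.1
      obtain ⟨⟨-, -, h1⟩, -, h2, h3⟩ := hc
      simp only at h1 h2 h3
      rw [abs_of_nonneg (by linarith)] at h
      rw [hsum, pathSum_append]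
      simp only [pathSum_nil, List.map_nil, List.sum_nil]
      linarith
    · rw [hon]; simp [OnPiece]
  | succ k ih =>
    intro A P hlen hP
    obtain ⟨u, l, v, R, hR, hsum, hon, hA, hc, hRe⟩ := exists_least_piece E g A B P
      (by rintro rfl; simp at hlen) hP
    obtain ⟨u', l', v', R', hR', hsum', hon', hA', hc', hRe'⟩ := exists_least_piece E g (g u) B R
      (by rintro rfl; simp at hR; omega) hRe
    have huu' := hE u u' hc.1.1 hc'.1.1
    rw [abs_sub_comm, abs_of_nonneg (by linarith)] at huu'
    -- The piece with least endpoint `u` is merged into the one with the next least start `u'`, so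
    -- that all remaining endpoints have coordinate at least `g u'`. The merge may cost at most `2 *
    -- (g u' - g u)`. If `v` comes before `u'`, the first piece becomes an excursion from `u'` to
    -- `u`, along the piece to `v`, and back to `u'`. Otherwise the reversed first piece, from `v`
    -- to `u`, is prolonged to `u'`, and `v` stays as an endpoint.
    rcases le_total (g v) (g u') with h | h
    · obtain ⟨x, L, hle, hmem⟩ := ih (g u') ((u', u :: l ++ [v, u'] ++ l', v') :: R')
        (by simp; omega) (by
          rintro c (_ | ⟨_, hc⟩)
          · exact ⟨hc'.1, hc'.2⟩
          · exact hRe' c ‹_›)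
      refine ⟨x, L, ?_, fun y => ?_⟩
      · refine hle.trans ?_
        have hv := hE v u' hc.2.1 hc'.1.1
        rw [abs_sub_comm, abs_of_nonneg (by linarith)] at hv
        have hvu := hc.2.2.1
        simp only at hvu
        rw [List.map_cons, List.sum_cons, hsum, hsum', pieceLength]
        simp only [List.cons_append, List.append_assoc, List.nil_append, pathSum_cons,
          pathSum_append]
        linarith [dist_comm u u']
      · rw [hmem, hon, hon', ← or_assoc]
        simp only [List.mem_cons (b := (_, _)), exists_eq_or_imp]
        refine or_congr_left ?_
        simp only [OnPiece, List.cons_append, List.append_assoc, List.nil_append, List.mem_cons,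
          List.mem_append]
        generalize (y = u) = q₁, (y = v) = q₂, (y = u') = q₃, (y = v') = q₄
        tauto
    · obtain ⟨x, L, hle, hmem⟩ := ih (g u') ((v, l.reverse ++ [u, u'] ++ l', v') :: R')
        (by simp; omega) (by
          rintro c (_ | ⟨_, hc⟩)
          · exact ⟨⟨hc.2.1, h, hc.2.2.2⟩, hc'.2⟩
          · exact hRe' c ‹_›)
      refine ⟨x, L, ?_, fun y => ?_⟩
      · refine hle.trans ?_
        rw [List.map_cons, List.sum_cons, hsum, hsum', pieceLength]
        simp only [List.cons_append, List.append_assoc, List.nil_append, pathSum_cons,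
          pathSum_append]
        rw [pathSum_reverse _ dist_comm]
        linarith
      · rw [hmem, hon, hon', ← or_assoc]
        simp only [List.mem_cons (b := (_, _)), exists_eq_or_imp]
        refine or_congr_left ?_
        simp only [OnPiece, List.cons_append, List.append_assoc, List.nil_append, List.mem_cons,
          List.mem_append, List.mem_reverse]
        generalize (y = u) = q₁, (y = v) = q₂, (y = u') = q₃, (y = v') = q₄
        tauto

end Join

/-! ### Cutting a closed walk along a line -/

section Split

variable {X : Type*} [PseudoMetricSpace X]

/-- A path that ends on the line `E` splits into pieces that lie on one side `H` or the other, have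
their endpoints on `E` (except for the start of the first one), and have the same total length. -/
theorem exists_pieces (Q E H : X → Prop)
    (hcross : ∀ x y, Q x → Q y → (H x ↔ ¬ H y) → ∃ q, Q q ∧ E q ∧ dist x q + dist q y = dist x y)
    (b : X) (hb : Q b ∧ E b) (l : List X) (hl : ∀ x ∈ l, Q x) (a : X) (ha : Q a) :
    ∃ (M : List X) (v : X) (P : List (X × List X × X)), (Q v ∧ E v) ∧
      (∀ x ∈ M, Q x ∧ (H x ↔ H a)) ∧
      (∀ c ∈ P, (Q c.1 ∧ E c.1) ∧ (Q c.2.2 ∧ E c.2.2) ∧ (∀ x ∈ c.2.1, Q x) ∧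
        ((∀ x ∈ c.2.1, H x) ∨ ∀ x ∈ c.2.1, ¬ H x)) ∧
      pathSum dist a M v + (P.map pieceLength).sum = pathSum dist a l b ∧
      ∀ x ∈ l, x ∈ M ∨ ∃ c ∈ P, x ∈ c.2.1 := by
  induction l generalizing a with
  | nil => exact ⟨[], b, [], hb, by simp, by simp, by simp, by simp⟩
  | cons x l ih =>
    have hx := hl x List.mem_cons_self
    obtain ⟨M, v, P, hv, hM, hP, hlen, hcov⟩ := ih (fun y hy => hl y (List.mem_cons_of_mem _ hy)) x hx
    -- `M` is the unfinished piece at the front. A vertex on the same side as `x` extends it;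
    -- otherwise the edge from `a` to `x` is subdivided at `q`, which completes the piece `(q, x ::
    -- M, v)` and leaves an empty unfinished piece from `a` to `q`.
    by_cases h : H x ↔ H a
    · refine ⟨x :: M, v, P, hv, ?_, hP, ?_, ?_⟩
      · rintro y (_ | ⟨_, hy⟩)
        · exact ⟨hx, h⟩
        · exact ⟨(hM y hy).1, (hM y hy).2.trans h⟩
      · rw [pathSum_cons, pathSum_cons, ← hlen, add_assoc]
      · rintro y (_ | ⟨_, hy⟩)
        · exact Or.inl List.mem_cons_self
        · exact (hcov y hy).imp_left (List.mem_cons_of_mem _)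
    · obtain ⟨q, hq, hqE, hd⟩ := hcross a x ha hx (by tauto)
      refine ⟨[], q, (q, x :: M, v) :: P, ⟨hq, hqE⟩, by simp, ?_, ?_, ?_⟩
      · rintro c (_ | ⟨_, hc⟩)
        · refine ⟨⟨hq, hqE⟩, hv, ?_, ?_⟩
          · rintro y (_ | ⟨_, hy⟩)
            exacts [hx, (hM y hy).1]
          · by_cases hHx : H x
            · refine Or.inl ?_
              rintro y (_ | ⟨_, hy⟩)
              exacts [hHx, (hM y hy).2.2 hHx]
            · refine Or.inr ?_
              rintro y (_ | ⟨_, hy⟩)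
              exacts [hHx, fun h => hHx ((hM y hy).2.1 h)]
        · exact hP c hc
      · rw [List.map_cons, List.sum_cons, pieceLength, pathSum_cons, pathSum_cons, pathSum_nil,
          ← hlen, ← hd]
        ring
      · rintro y (_ | ⟨_, hy⟩)
        · exact Or.inr ⟨_, List.mem_cons_self, List.mem_cons_self⟩
        · rcases hcov y hy with h | ⟨c, hc, h⟩
          · exact Or.inr ⟨_, List.mem_cons_self, List.mem_cons_of_mem _ h⟩
          · exact Or.inr ⟨c, List.mem_cons_of_mem _ hc, h⟩

/-- A path from one side to the other can be subdivided at a point of the line. -/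
theorem exists_crossing (Q E H : X → Prop)
    (hcross : ∀ x y, Q x → Q y → (H x ↔ ¬ H y) → ∃ q, Q q ∧ E q ∧ dist x q + dist q y = dist x y)
    (b : X) (hb : Q b) (l : List X) (hl : ∀ x ∈ l, Q x) (a : X) (ha : Q a) (hab : H a ↔ ¬ H b) :
    ∃ l₁ q l₂, l = l₁ ++ l₂ ∧ Q q ∧ E q ∧
      pathSum dist a l₁ q + pathSum dist q l₂ b = pathSum dist a l b := by
  induction l generalizing a with
  | nil =>
    obtain ⟨q, hq, hqE, hd⟩ := hcross a b ha hb hab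
    exact ⟨[], q, [], rfl, hq, hqE, hd⟩
  | cons x l ih =>
    have hx := hl x List.mem_cons_self
    by_cases h : H x ↔ H a
    · obtain ⟨l₁, q, l₂, rfl, hq, hqE, hd⟩ := ih (fun y hy => hl y (List.mem_cons_of_mem _ hy)) x hx
        (h.trans hab)
      exact ⟨x :: l₁, q, l₂, rfl, hq, hqE, by rw [pathSum_cons, pathSum_cons, ← hd, add_assoc]⟩
    · obtain ⟨q, hq, hqE, hd⟩ := hcross a x ha hx (by tauto)
      exact ⟨[], q, x :: l, rfl, hq, hqE, by
        rw [pathSum_cons, pathSum_cons, pathSum_nil, ← hd, add_assoc]⟩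

/-- A closed walk that meets both sides can be started at a point of the line. -/
theorem exists_closed_from_line (Q E H : X → Prop)
    (hcross : ∀ x y, Q x → Q y → (H x ↔ ¬ H y) → ∃ q, Q q ∧ E q ∧ dist x q + dist q y = dist x y)
    (x : X) (l : List X) (hl : ∀ y ∈ x :: l, Q y) (h1 : ∃ y ∈ x :: l, H y)
    (h2 : ∃ y ∈ x :: l, ¬ H y) :
    ∃ q L, Q q ∧ E q ∧ (∀ y, y ∈ L ↔ y ∈ x :: l) ∧ pathSum dist q L q = pathSum dist x l x := by
  obtain ⟨y, hy, hxy⟩ : ∃ y ∈ l, (H x ↔ ¬ H y) := by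
    obtain ⟨y, hy, hHy⟩ := h1
    obtain ⟨z, hz, hHz⟩ := h2
    rw [List.mem_cons] at hy hz
    by_cases hx : H x
    · exact ⟨z, hz.resolve_left (by rintro rfl; exact hHz hx), by tauto⟩
    · exact ⟨y, hy.resolve_left (by rintro rfl; exact hx hHy), by tauto⟩
  -- The stretch from `x` to the opposite vertex `y` contains a crossing point `q`; the cyclic walk
  -- is rotated to start there.
  obtain ⟨s, t, rfl⟩ := List.append_of_mem hy
  obtain ⟨l₁, q, l₂, rfl, hq, hqE, hd⟩ := exists_crossing Q E H hcross y (hl y (by simp)) s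
    (fun z hz => hl z (by simp [hz])) x (hl x (by simp)) hxy
  refine ⟨q, l₂ ++ y :: t ++ x :: l₁, hq, hqE, fun z => ?_, ?_⟩
  · simp; tauto
  · simp only [pathSum_append]
    rw [← hd]; ring

/-- Cutting a closed walk along a segment of length at most `B - A` of the line `E`: the parts on the
two sides can be closed up at an additional cost of at most `2 * (B - A)` each. -/
theorem exists_cut (Q E H : X → Prop) (g : X → ℝ) (A B : ℝ)
    (hcross : ∀ x y, Q x → Q y → (H x ↔ ¬ H y) → ∃ q, Q q ∧ E q ∧ dist x q + dist q y = dist x y)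
    (hE : ∀ u v, E u → E v → dist u v ≤ |g u - g v|) (hg : ∀ u, Q u → A ≤ g u ∧ g u ≤ B)
    (x : X) (l : List X) (hl : ∀ y ∈ x :: l, Q y) (h1 : ∃ y ∈ x :: l, H y)
    (h2 : ∃ y ∈ x :: l, ¬ H y) :
    ∃ x₁ l₁ x₂ l₂, (∀ y ∈ x₁ :: l₁, Q y ∧ (H y ∨ E y)) ∧ (∀ y ∈ x₂ :: l₂, Q y ∧ (¬ H y ∨ E y)) ∧
      (∀ y ∈ x :: l, H y → y ∈ x₁ :: l₁) ∧ (∀ y ∈ x :: l, ¬ H y → y ∈ x₂ :: l₂) ∧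
      pathSum dist x₁ l₁ x₁ + pathSum dist x₂ l₂ x₂ ≤ pathSum dist x l x + 4 * (B - A) := by
  classical
  obtain ⟨q, L, hq, hqE, hL, hlen⟩ := exists_closed_from_line Q E H hcross x l hl h1 h2
  obtain ⟨M, v, P, hv, hM, hP, hPlen, hcov⟩ := exists_pieces Q E H hcross q ⟨hq, hqE⟩ L
    (fun y hy => hl y ((hL y).1 hy)) q hq
  -- Since the rotated walk starts at `q` on the line, the unfinished piece also has both endpoints
  -- on the line and joins the others.
  obtain ⟨R, hR, hRlen, hRcov⟩ : ∃ R : List (X × List X × X),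
      (∀ c ∈ R, (Q c.1 ∧ E c.1) ∧ (Q c.2.2 ∧ E c.2.2) ∧ (∀ x ∈ c.2.1, Q x) ∧
        ((∀ x ∈ c.2.1, H x) ∨ ∀ x ∈ c.2.1, ¬ H x)) ∧
      (R.map pieceLength).sum = pathSum dist x l x ∧ ∀ y ∈ x :: l, ∃ c ∈ R, y ∈ c.2.1 := by
    refine ⟨(q, M, v) :: P, ?_, ?_, fun y hy => ?_⟩
    · rintro c (_ | ⟨_, hc⟩)
      · refine ⟨⟨hq, hqE⟩, hv, fun y hy => (hM y hy).1, ?_⟩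
        by_cases h : H q
        · exact Or.inl fun y hy => (hM y hy).2.2 h
        · exact Or.inr fun y hy h' => h ((hM y hy).2.1 h')
      · exact hP c hc
    · rw [List.map_cons, List.sum_cons, pieceLength, ← hlen, ← hPlen]
    · rcases hcov y ((hL y).2 hy) with h | ⟨c, hc, h⟩
      · exact ⟨_, List.mem_cons_self, h⟩
      · exact ⟨c, List.mem_cons_of_mem _ hc, h⟩
  have side : ∀ R' : List (X × List X × X), (∀ c ∈ R', c ∈ R) → R' ≠ [] →
      ∃ x' l', pathSum dist x' l' x' ≤ (R'.map pieceLength).sum + 2 * (B - A) ∧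
        ∀ y, y ∈ x' :: l' ↔ ∃ c ∈ R', OnPiece y c := fun R' hsub hne => by
    refine exists_closed_of_pieces E g hE B (R'.length - 1) A R' ?_ fun c hc => ?_
    · have := List.length_pos_iff.2 hne; omega
    · obtain ⟨hc1, hc2, -⟩ := hR c (hsub c hc)
      exact ⟨⟨hc1.2, hg _ hc1.1⟩, hc2.2, hg _ hc2.1⟩
  obtain ⟨y₁, hy₁, hH₁⟩ := h1
  obtain ⟨y₂, hy₂, hH₂⟩ := h2
  -- Pieces without interior vertices satisfy both alternatives; the filter puts them on the side
  -- `H`, so each piece is counted once.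
  have cov1 : ∀ y ∈ x :: l, H y → ∃ c ∈ R.filter (fun c => decide (∀ z ∈ c.2.1, H z)), y ∈ c.2.1 := by
    intro y hy hHy
    obtain ⟨c, hc, hyc⟩ := hRcov y hy
    refine ⟨c, List.mem_filter.2 ⟨hc, decide_eq_true ?_⟩, hyc⟩
    exact (hR c hc).2.2.2.resolve_right fun h => h y hyc hHy
  have cov2 : ∀ y ∈ x :: l, ¬ H y →
      ∃ c ∈ R.filter (fun c => !decide (∀ z ∈ c.2.1, H z)), y ∈ c.2.1 := by
    intro y hy hHy
    obtain ⟨c, hc, hyc⟩ := hRcov y hy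
    refine ⟨c, List.mem_filter.2 ⟨hc, ?_⟩, hyc⟩
    rw [Bool.not_eq_true', decide_eq_false_iff_not]
    exact fun h => hHy (h y hyc)
  obtain ⟨x₁, l₁, hle1, hmem1⟩ := side (R.filter fun c => decide (∀ z ∈ c.2.1, H z))
    (fun c hc => List.mem_of_mem_filter hc)
    (by obtain ⟨c, hc, -⟩ := cov1 y₁ hy₁ hH₁; exact List.ne_nil_of_mem hc)
  obtain ⟨x₂, l₂, hle2, hmem2⟩ := side (R.filter fun c => !decide (∀ z ∈ c.2.1, H z))
    (fun c hc => List.mem_of_mem_filter hc)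
    (by obtain ⟨c, hc, -⟩ := cov2 y₂ hy₂ hH₂; exact List.ne_nil_of_mem hc)
  refine ⟨x₁, l₁, x₂, l₂, fun y hy => ?_, fun y hy => ?_, fun y hy hHy => ?_, fun y hy hHy => ?_, ?_⟩
  · obtain ⟨c, hc, hyc⟩ := (hmem1 y).1 hy
    obtain ⟨hcR, hcH⟩ := List.mem_filter.1 hc
    obtain ⟨hc1, hc2, hcQ, -⟩ := hR c hcR
    rcases hyc with rfl | h | rfl
    exacts [⟨hc1.1, Or.inr hc1.2⟩, ⟨hcQ y h, Or.inl (of_decide_eq_true hcH y h)⟩,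
      ⟨hc2.1, Or.inr hc2.2⟩]
  · obtain ⟨c, hc, hyc⟩ := (hmem2 y).1 hy
    obtain ⟨hcR, hcH⟩ := List.mem_filter.1 hc
    rw [Bool.not_eq_true', decide_eq_false_iff_not] at hcH
    obtain ⟨hc1, hc2, hcQ, hside⟩ := hR c hcR
    rcases hyc with rfl | h | rfl
    exacts [⟨hc1.1, Or.inr hc1.2⟩, ⟨hcQ y h, Or.inl (hside.resolve_left hcH y h)⟩,
      ⟨hc2.1, Or.inr hc2.2⟩]
  · obtain ⟨c, hc, h⟩ := cov1 y hy hHy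
    exact (hmem1 y).2 ⟨c, hc, Or.inr (Or.inl h)⟩
  · obtain ⟨c, hc, h⟩ := cov2 y hy hHy
    exact (hmem2 y).2 ⟨c, hc, Or.inr (Or.inl h)⟩
  · have hperm := (List.filter_append_perm (fun c : X × List X × X => decide (∀ z ∈ c.2.1, H z)) R)
    have := (hperm.map pieceLength).sum_eq
    rw [List.map_append, List.sum_append] at this
    linarith

end Split

/-! ### Dissecting a closed walk in the unit square -/

theorem dist_le_abs_add_abs (u v : Plane) : dist u v ≤ |u 0 - v 0| + |u 1 - v 1| := by
  rw [EuclideanSpace.dist_eq, Fin.sum_univ_two, Real.dist_eq, Real.dist_eq]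
  refine Real.sqrt_le_iff.2 ⟨by positivity, ?_⟩
  nlinarith [abs_nonneg (u 0 - v 0), abs_nonneg (u 1 - v 1)]

theorem dist_le_of_coord_eq {i j : Fin 2} (hij : i ≠ j) {u v : Plane} (h : u i = v i) :
    dist u v ≤ |u j - v j| := by
  have := dist_le_abs_add_abs u v
  fin_cases i <;> fin_cases j <;> simp_all

/-- The axis-parallel rectangle with opposite corners `lo` and `hi`. -/
def box (lo hi : Fin 2 → ℝ) : Set Plane := {x | ∀ k, lo k ≤ x k ∧ x k ≤ hi k}

/-- Some closed walk of length at most `C` stays in `B` and visits all points of `S`. -/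
def HasClosedWalk (B S : Set Plane) (C : ℝ) : Prop :=
  ∃ x l, (∀ y ∈ x :: l, y ∈ B) ∧ (∀ y ∈ S, y ∈ x :: l) ∧ pathSum dist x l x ≤ C

theorem HasClosedWalk.mono {B B' S S' : Set Plane} {C C' : ℝ} (h : HasClosedWalk B S C)
    (hB : B ⊆ B') (hS : S' ⊆ S) (hC : C ≤ C') : HasClosedWalk B' S' C' := by
  obtain ⟨x, l, h1, h2, h3⟩ := h
  exact ⟨x, l, fun y hy => hB (h1 y hy), fun y hy => h2 y (hS hy), h3.trans hC⟩

/-- The segment from `x` to `y` meets the line at an affine parameter `s` in `[0, 1]`, and the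
rectangle is convex. This is the crossing hypothesis of `exists_cut`. -/
theorem exists_crossing_point (lo hi : Fin 2 → ℝ) (i : Fin 2) (t : ℝ) (x y : Plane)
    (hx : x ∈ box lo hi) (hy : y ∈ box lo hi) (h : x i < t ↔ ¬ y i < t) :
    ∃ q ∈ box lo hi, q i = t ∧ dist x q + dist q y = dist x y := by
  obtain ⟨s, hs0, hs1, hs⟩ : ∃ s : ℝ, 0 ≤ s ∧ s ≤ 1 ∧ x i + s * (y i - x i) = t := by
    rcases lt_or_ge (x i) t with h1 | h1
    · have h2 := not_lt.1 (h.1 h1)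
      have h3 : 0 < y i - x i := by linarith
      refine ⟨(t - x i) / (y i - x i), div_nonneg (by linarith) h3.le,
        (div_le_one h3).2 (by linarith), ?_⟩
      rw [div_mul_cancel₀ _ h3.ne']; ring
    · have h2 : y i < t := by by_contra h2; exact absurd (h.2 h2) (not_lt.2 h1)
      have h3 : 0 < x i - y i := by linarith
      refine ⟨(x i - t) / (x i - y i), div_nonneg (by linarith) h3.le,
        (div_le_one h3).2 (by linarith), ?_⟩
      rw [← neg_sub (x i) (y i), mul_neg, div_mul_cancel₀ _ h3.ne']; ring
  have hcoord : ∀ k, (AffineMap.lineMap x y s : Plane) k = x k + s * (y k - x k) := fun k => by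
    simp [AffineMap.lineMap_apply, add_comm]
  refine ⟨AffineMap.lineMap x y s, fun k => ?_, by rw [hcoord, hs], ?_⟩
  · rw [hcoord]
    have := hx k
    have := hy k
    constructor <;> nlinarith
  · rw [dist_left_lineMap, dist_lineMap_right, Real.norm_of_nonneg hs0,
      Real.norm_of_nonneg (by linarith)]
    ring

theorem box_update_hi {lo hi : Fin 2 → ℝ} {i : Fin 2} {t : ℝ} {x : Plane} (hx : x ∈ box lo hi)
    (h : x i ≤ t) : x ∈ box lo (Function.update hi i t) := fun k => by
  by_cases hk : k = i
  · subst hk; simpa using ⟨(hx k).1, h⟩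
  · simpa [hk] using hx k

theorem box_update_lo {lo hi : Fin 2 → ℝ} {i : Fin 2} {t : ℝ} {x : Plane} (hx : x ∈ box lo hi)
    (h : t ≤ x i) : x ∈ box (Function.update lo i t) hi := fun k => by
  by_cases hk : k = i
  · subst hk; simpa using ⟨h, (hx k).2⟩
  · simpa [hk] using hx k

/-- Cutting a closed walk in a rectangle into two. -/
theorem HasClosedWalk.cut {i j : Fin 2} (hij : i ≠ j) {lo hi : Fin 2 → ℝ} {S : Set Plane} {C : ℝ}
    (h : HasClosedWalk (box lo hi) S C) {t : ℝ} (h1 : lo i ≤ t) (h2 : t ≤ hi i) :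
    ∃ C₁ C₂, C₁ + C₂ ≤ C + 4 * (hi j - lo j) ∧
      HasClosedWalk (box lo (Function.update hi i t)) (S ∩ {x | x i < t}) C₁ ∧
      HasClosedWalk (box (Function.update lo i t) hi) (S ∩ {x | t ≤ x i}) C₂ := by
  obtain ⟨x, l, hB, hS, hC⟩ := h
  have hle : ∀ k, lo k ≤ hi k := fun k =>
    (hB x List.mem_cons_self k).1.trans (hB x List.mem_cons_self k).2
  have hj := hle j
  by_cases hlow : ∃ y ∈ x :: l, y i < t
  · by_cases hupp : ∃ y ∈ x :: l, ¬ y i < t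
    · obtain ⟨x₁, l₁, x₂, l₂, hB1, hB2, hc1, hc2, hlen⟩ := exists_cut (· ∈ box lo hi) (· i = t)
        (· i < t) (· j) (lo j) (hi j)
        (fun x y hx hy h => exists_crossing_point lo hi i t x y hx hy h)
        (fun u v hu hv => dist_le_of_coord_eq hij (hu.trans hv.symm)) (fun u hu => hu j) x l hB
        hlow hupp
      refine ⟨_, _, hlen.trans (by linarith), ⟨x₁, l₁, fun y hy => ?_, fun y hy => ?_, le_rfl⟩,
        ⟨x₂, l₂, fun y hy => ?_, fun y hy => ?_, le_rfl⟩⟩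
      · obtain ⟨h, h'⟩ := hB1 y hy
        exact box_update_hi h (h'.elim le_of_lt le_of_eq)
      · exact hc1 y (hS y hy.1) hy.2
      · obtain ⟨h, h'⟩ := hB2 y hy
        exact box_update_lo h (h'.elim not_lt.1 ge_of_eq)
      · exact hc2 y (hS y hy.1) (not_lt.2 hy.2)
    -- A walk on one side of the line is kept whole. The other side contains no point of `S`, and a
    -- corner of its rectangle serves as a walk of length `0`.
    · push Not at hupp
      refine ⟨C, 0, by linarith, ⟨x, l, fun y hy => box_update_hi (hB y hy) (hupp y hy).le,
        fun y hy => hS y hy.1, hC⟩, ⟨WithLp.toLp 2 hi, [], ?_, fun y hy => ?_, by simp⟩⟩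
      · simp only [List.mem_cons, List.not_mem_nil, or_false, forall_eq]
        exact box_update_lo (fun k => ⟨hle k, le_rfl⟩) h2
      · exact absurd (hupp y (hS y hy.1)) (not_lt.2 hy.2)
  · push Not at hlow
    refine ⟨0, C, by linarith, ⟨WithLp.toLp 2 lo, [], ?_, fun y hy => ?_, by simp⟩,
      ⟨x, l, fun y hy => box_update_lo (hB y hy) (hlow y hy), fun y hy => hS y hy.1, hC⟩⟩
    · simp only [List.mem_cons, List.not_mem_nil, or_false, forall_eq]
      exact box_update_hi (fun k => ⟨le_rfl, hle k⟩) h1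
    · exact absurd hy.2 (not_lt.2 (hlow y (hS y hy.1)))

/-- Cutting a closed walk in a rectangle into `k + 1` slices of width `1 / m`. -/
theorem HasClosedWalk.slices {i j : Fin 2} (hij : i ≠ j) {m : ℕ} (hm : 0 < m) {lo : Fin 2 → ℝ}
    (hlo : lo i = 0) (k : ℕ) :
    ∀ {hi : Fin 2 → ℝ} {S : Set Plane} {C : ℝ}, hi i = (k + 1 : ℕ) / m →
    HasClosedWalk (box lo hi) S C →
    ∃ D : ℕ → ℝ, ∑ r ∈ Finset.range (k + 1), D r ≤ C + k * (4 * (hi j - lo j)) ∧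
      ∀ r ∈ Finset.range (k + 1),
        HasClosedWalk (box (Function.update lo i (r / m)) (Function.update hi i ((r + 1 : ℕ) / m)))
          (S ∩ {x | min ⌊(m : ℝ) * x i⌋₊ k = r}) (D r) := by
  have hm' : (0 : ℝ) < m := Nat.cast_pos.2 hm
  induction k with
  | zero =>
    intro hi S C hhi h
    refine ⟨fun _ => C, by simp, fun r hr => ?_⟩
    obtain rfl : r = 0 := by simpa using hr
    have e1 : Function.update lo i (((0 : ℕ) : ℝ) / m) = lo := by
      rw [Function.update_eq_self_iff, hlo]; simp
    rw [e1, ← hhi, Function.update_eq_self]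
    exact h.mono le_rfl Set.inter_subset_left le_rfl
  | succ k ih =>
    intro hi S C hhi h
    -- One cut removes the last slice, so `k + 1` slices take only `k` cuts. The clamp by `k` in the
    -- statement assigns the closed far side to the last slice.
    obtain ⟨C₁, C₂, hC, hw1, hw2⟩ := h.cut hij (t := (k + 1 : ℕ) / m) (by rw [hlo]; positivity)
      (by rw [hhi]; gcongr; omega)
    obtain ⟨D, hD, hDw⟩ := ih (by simp) hw1
    refine ⟨fun r => if r = k + 1 then C₂ else D r, ?_, fun r hr => ?_⟩
    · rw [Finset.sum_range_succ, if_pos rfl, Finset.sum_congr rfl (g := D) fun r hr => if_neg ?_]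
      · rw [Function.update_of_ne hij.symm] at hD
        push_cast
        linarith
      · have := Finset.mem_range.1 hr; omega
    · by_cases hrk : r = k + 1
      · subst hrk
        simp only [if_true]
        rw [← hhi, Function.update_eq_self]
        refine hw2.mono le_rfl (fun x hx => ⟨hx.1, ?_⟩) le_rfl
        have h1 : k + 1 ≤ ⌊(m : ℝ) * x i⌋₊ := min_eq_right_iff.1 hx.2
        have h2 := (Nat.le_floor_iff' (by omega)).1 h1
        change ((k + 1 : ℕ) : ℝ) / m ≤ x i
        rwa [div_le_iff₀' hm']
      · simp only [if_neg hrk]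
        have hrk' : r < k + 1 := by have := Finset.mem_range.1 hr; omega
        have := hDw r (Finset.mem_range.2 hrk')
        rw [Function.update_idem] at this
        refine this.mono le_rfl (fun x hx => ⟨⟨hx.1, ?_⟩, ?_⟩) le_rfl
        · have h1 : ⌊(m : ℝ) * x i⌋₊ < k + 1 := by
            have := hx.2; simp only [Set.mem_ofPred_eq] at this; omega
          change x i < ((k + 1 : ℕ) : ℝ) / m
          rw [lt_div_iff₀' hm']
          exact (Nat.floor_lt' (by omega)).1 h1
        · have := hx.2; simp only [Set.mem_ofPred_eq] at this ⊢; omega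

/-- A closed walk in the unit square splits into closed walks in the `m ^ 2` subsquares at an
additional cost of at most `8 * m`. -/
theorem HasClosedWalk.subsquares {m : ℕ} (hm : 0 < m) {S : Set Plane} {C : ℝ}
    (h : HasClosedWalk (box 0 1) S C) :
    ∃ D : ℕ × ℕ → ℝ, ∑ c ∈ cells m, D c ≤ C + 8 * m ∧
      ∀ c ∈ cells m, HasClosedWalk Set.univ (S ∩ {x | cellOf m x = c}) (D c) := by
  have hm' : (0 : ℝ) < m := Nat.cast_pos.2 hm
  obtain ⟨k, rfl⟩ : ∃ k, m = k + 1 := ⟨m - 1, by omega⟩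
  obtain ⟨D, hD, hDw⟩ := h.slices (i := 0) (j := 1) (by decide) hm rfl k
    (by simpa using (div_self hm'.ne').symm)
  have hcol : ∀ r, ∃ D' : ℕ → ℝ, r ∈ Finset.range (k + 1) →
      ∑ s ∈ Finset.range (k + 1), D' s ≤ D r + 4 ∧ ∀ s ∈ Finset.range (k + 1),
        HasClosedWalk Set.univ (S ∩ {x | cellOf (k + 1) x = (r, s)}) (D' s) := fun r => by
    by_cases hr : r ∈ Finset.range (k + 1)
    · obtain ⟨D', hD', hw⟩ := (hDw r hr).slices (i := 1) (j := 0) (by decide) hm (by simp) k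
        (by simpa using (div_self hm'.ne').symm)
      refine ⟨D', fun _ => ⟨hD'.trans ?_, fun s hs => (hw s hs).mono (Set.subset_univ _) ?_ le_rfl⟩⟩
      · simp only [Function.update_self]
        -- Cuts inside a column have length `1 / m`, so each column costs at most `4`, and all
        -- columns at most `4 * m`. The vertical cuts, of length `1`, cost another `4 * k`.
        have : (k : ℝ) * (4 * (((r + 1 : ℕ) : ℝ) / (k + 1 : ℕ) - r / (k + 1 : ℕ))) ≤ 4 := by
          rw [← sub_div]
          push_cast at hm' ⊢
          rw [add_sub_cancel_left, mul_left_comm, mul_one_div]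
          have := (div_le_one hm').2 (by linarith : (k : ℝ) ≤ k + 1)
          linarith
        linarith
      · rintro x ⟨hx, hc⟩
        simp only [cellOf, Set.mem_ofPred_eq, Prod.mk.injEq, Nat.add_sub_cancel] at hc
        exact ⟨⟨hx, hc.1⟩, hc.2⟩
    · exact ⟨0, fun h => absurd h hr⟩
  choose D' hD' using hcol
  refine ⟨fun c => D' c.1 c.2, ?_, fun c hc => ?_⟩
  · rw [cells, Finset.sum_product]
    refine (Finset.sum_le_sum fun r hr => (hD' r hr).1).trans ?_
    rw [Finset.sum_add_distrib, Finset.sum_const, Finset.card_range]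
    simp only [Pi.one_apply, Pi.zero_apply, sub_zero, mul_one] at hD
    push_cast
    rw [nsmul_eq_mul]
    push_cast
    linarith
  · obtain ⟨h1, h2⟩ := Finset.mem_product.1 hc
    exact (hD' c.1 h1).2 c.2 h2

/-- Karp's bound: the optimal tours in the subsquares are together not much longer than a tour of
all points. -/
theorem sum_walkLength_subtours_le {n m : ℕ} (hn : 0 < n) (hm : 0 < m) (p : Fin n → Plane)
    (hp : ∀ v, p v ∈ unitSquare) (T : List (Fin n)) (hT : IsTour Finset.univ T)
    (sub : ℕ × ℕ → List (Fin n))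
    (hsub : ∀ c ∈ cells m, IsOptimalTour p (pointsIn m p c) (sub c)) :
    ∑ c ∈ cells m, walkLength p (sub c) ≤ walkLength p T + 8 * m := by
  have h0 : HasClosedWalk (box 0 1) (Set.range p) (walkLength p T) := by
    cases T with
    | nil => simpa using (hT.2 ⟨0, hn⟩).2 (Finset.mem_univ _)
    | cons a l =>
      refine ⟨p a, l.map p, fun y hy => ?_, ?_, (walkLength_cons p a l).ge⟩
      · rw [← List.map_cons, List.mem_map] at hy
        obtain ⟨v, -, rfl⟩ := hy
        exact fun k => hp v k
      · rintro _ ⟨v, rfl⟩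
        rw [← List.map_cons]
        exact List.mem_map_of_mem ((hT.2 v).2 (Finset.mem_univ _))
  obtain ⟨D, hD, hDw⟩ := h0.subsquares hm
  refine (Finset.sum_le_sum fun c hc => ?_).trans hD
  obtain ⟨x, l, -, hcov, hlen⟩ := hDw c hc
  obtain ⟨T', hT', hle⟩ := exists_tour_pathSum_le p (x :: l) x x (pointsIn m p c) fun v hv =>
    hcov _ ⟨⟨v, rfl⟩, (Finset.mem_filter.1 hv).2⟩
  rw [pathSum_cons, dist_self, zero_add] at hle
  exact ((hsub c hc).2 T' hT').trans ((walkLength_le_pathSum p x T').trans (hle.trans hlen))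

/-! ### The length of the tour of representatives -/

section Perturb

variable {α X : Type*} [PseudoMetricSpace X]

/-- Moving both ends of an edge by at most `δ` changes its length by at most `2 * δ`, and the path
has `l.length + 1` edges. -/
theorem pathSum_dist_perturb (f g : α → X) (δ : ℝ) (a : α) (l : List α) (b : α)
    (h : ∀ x ∈ a :: b :: l, dist (f x) (g x) ≤ δ) :
    pathSum dist (f a) (l.map f) (f b) ≤
      pathSum dist (g a) (l.map g) (g b) + 2 * δ * (l.length + 1) := by
  have step : ∀ x ∈ a :: b :: l, ∀ y ∈ a :: b :: l,
      dist (f x) (f y) ≤ dist (g x) (g y) + 2 * δ := fun x hx y hy => by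
    have h1 := dist_triangle4 (f x) (g x) (g y) (f y)
    have h2 := h x hx
    have h3 := h y hy
    rw [dist_comm] at h3
    linarith
  induction l generalizing a with
  | nil => simpa using step a (by simp) b (by simp)
  | cons x l ih =>
    have h1 := ih x (fun y hy => h y (by simp at hy ⊢; tauto))
      (fun y hy z hz => step y (by simp at hy ⊢; tauto) z (by simp at hz ⊢; tauto))
    have h2 := step a (by simp) x (by simp)
    simp only [List.map_cons, pathSum_cons, List.length_cons]
    push_cast
    linarith

theorem pathSum_dist_le_of_isChain (δ D : ℝ) (a : X) (l : List X) (b : X)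
    (h : (a :: l).IsChain fun x y => dist x y ≤ δ) (hD : ∀ x ∈ a :: l, dist x b ≤ D) :
    pathSum dist a l b ≤ δ * l.length + D := by
  induction l generalizing a with
  | nil => simpa using hD a (by simp)
  | cons x l ih =>
    rw [List.isChain_cons_cons] at h
    have h1 := ih x h.2 fun y hy => hD y (List.mem_cons_of_mem _ hy)
    simp only [pathSum_cons, List.length_cons]
    push_cast
    linarith [h.1]

theorem pathSum_dist_cons_sublist {a c : X} {l L : List X} (h : (a :: l).Sublist (c :: L)) (b : X) :
    pathSum dist a l b ≤ pathSum dist c L b := by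
  cases h with
  | cons _ h => exact (le_add_of_nonneg_left dist_nonneg).trans (pathSum_dist_sublist h c b)
  | cons_cons _ h => exact pathSum_dist_sublist h a b

end Perturb

section Boustrophedon

/-- One row of the boustrophedon order. -/
def boustrophedonRow (m j : ℕ) : List (ℕ × ℕ) :=
  (if Even j then List.range m else (List.range m).reverse).map fun i => (i, j)

theorem boustrophedon_eq_flatten (m : ℕ) :
    boustrophedon m = ((List.range m).map (boustrophedonRow m)).flatten := rfl

theorem mem_boustrophedonRow {m j : ℕ} {c : ℕ × ℕ} :
    c ∈ boustrophedonRow m j ↔ c.1 < m ∧ c.2 = j := by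
  obtain ⟨a, b⟩ := c
  rw [boustrophedonRow]
  split_ifs <;> simp [eq_comm]

theorem nodup_boustrophedonRow (m j : ℕ) : (boustrophedonRow m j).Nodup := by
  refine List.Nodup.map (fun a b h => congrArg Prod.fst h) ?_
  split_ifs
  exacts [List.nodup_range, List.nodup_reverse.2 List.nodup_range]

theorem nodup_boustrophedon (m : ℕ) : (boustrophedon m).Nodup := by
  refine List.nodup_flatMap.2 ⟨fun j _ => nodup_boustrophedonRow m j, ?_⟩
  refine List.nodup_range.imp fun {j j'} hne c hc hc' => hne ?_
  exact (mem_boustrophedonRow.1 hc).2.symm.trans (mem_boustrophedonRow.1 hc').2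

theorem mem_boustrophedon {m : ℕ} {c : ℕ × ℕ} : c ∈ boustrophedon m ↔ c ∈ cells m := by
  change c ∈ (List.range m).flatMap (boustrophedonRow m) ↔ _
  simp only [List.mem_flatMap, mem_boustrophedonRow, List.mem_range, cells, Finset.mem_product,
    Finset.mem_range]
  constructor
  · rintro ⟨j, h1, h2, rfl⟩
    exact ⟨h2, h1⟩
  · rintro ⟨h1, h2⟩
    exact ⟨_, h2, h1, rfl⟩

theorem length_boustrophedon (m : ℕ) : (boustrophedon m).length = m * m := by
  classical
  have : (boustrophedon m).toFinset = cells m := by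
    ext c; rw [List.mem_toFinset, mem_boustrophedon]
  rw [← List.toFinset_card_of_nodup (nodup_boustrophedon m), this, cells, Finset.card_product,
    Finset.card_range]

/-- The lower left corner of a subsquare. -/
noncomputable def corner (m : ℕ) (c : ℕ × ℕ) : Plane := !₂[(c.1 : ℝ) / m, (c.2 : ℝ) / m]

theorem dist_corner_le (m : ℕ) (c c' : ℕ × ℕ) :
    dist (corner m c) (corner m c') ≤ (|(c.1 : ℝ) - c'.1| + |(c.2 : ℝ) - c'.2|) / m := by
  refine (dist_le_abs_add_abs _ _).trans_eq ?_
  simp [corner, ← sub_div, abs_div, add_div]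

/-- Within a row the column changes by one; between rows the alternating direction keeps the column
fixed, at `m - 1` or at `0`. -/
theorem isChain_boustrophedon {m : ℕ} (hm : 0 < m) :
    (boustrophedon m).IsChain fun c c' => dist (corner m c) (corner m c') ≤ 1 / m := by
  have key : ∀ c c' : ℕ × ℕ, |(c.1 : ℝ) - c'.1| + |(c.2 : ℝ) - c'.2| ≤ 1 →
      dist (corner m c) (corner m c') ≤ 1 / m := fun c c' h =>
    (dist_corner_le m c c').trans (by gcongr)
  rw [boustrophedon_eq_flatten, List.isChain_flatten]
  · constructor
    · intro l hl
      obtain ⟨j, -, rfl⟩ := List.mem_map.1 hl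
      rw [boustrophedonRow, List.isChain_map]
      split_ifs
      · rw [List.isChain_range]
        exact fun i _ => key _ _ (by simp)
      · rw [List.isChain_reverse, List.isChain_range]
        exact fun i _ => key _ _ (by simp)
    · rw [List.isChain_map, List.isChain_range]
      intro i _ c hc c' hc'
      refine key _ _ ?_
      have hm0 : m ≠ 0 := hm.ne'
      by_cases hi : Even i
      · have hi' : ¬ Even (i + 1) := by simpa [Nat.even_add_one] using hi
        simp [boustrophedonRow, hi, hi', List.getLast?_range, hm0] at hc hc'
        subst hc hc'
        simp
      · have hi' : Even (i + 1) := by simpa [Nat.even_add_one] using hi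
        simp [boustrophedonRow, hi, hi', List.head?_range, hm0] at hc hc'
        subst hc hc'
        simp
  · intro h
    obtain ⟨j, -, hj⟩ := List.mem_map.1 h
    have : ((0 : ℕ), j) ∈ boustrophedonRow m j := mem_boustrophedonRow.2 ⟨hm, rfl⟩
    rw [hj] at this
    simp at this

end Boustrophedon

theorem abs_sub_floor_div_le {m : ℕ} (hm : 0 < m) {x : ℝ} (hx : x ∈ Set.Icc (0 : ℝ) 1) :
    |x - (min ⌊(m : ℝ) * x⌋₊ (m - 1) : ℕ) / m| ≤ 1 / m := by
  have hm' : (0 : ℝ) < m := Nat.cast_pos.2 hm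
  obtain ⟨h0, h1⟩ := hx
  have key : |(m : ℝ) * x - (min ⌊(m : ℝ) * x⌋₊ (m - 1) : ℕ)| ≤ 1 := by
    have hf := Nat.floor_le (mul_nonneg hm'.le h0)
    have hf' := Nat.lt_floor_add_one ((m : ℝ) * x)
    have hx1 : (m : ℝ) * x ≤ m := by nlinarith
    rcases min_cases ⌊(m : ℝ) * x⌋₊ (m - 1) with ⟨h, h'⟩ | ⟨h, h'⟩
    · rw [h, abs_le]; constructor <;> linarith
    · have h2 : ((m - 1 : ℕ) : ℝ) < ⌊(m : ℝ) * x⌋₊ := by exact_mod_cast h'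
      rw [h, abs_le, Nat.cast_sub hm]
      rw [Nat.cast_sub hm] at h2
      push_cast at h2 ⊢
      constructor <;> linarith
  have : x - (min ⌊(m : ℝ) * x⌋₊ (m - 1) : ℕ) / m =
      ((m : ℝ) * x - (min ⌊(m : ℝ) * x⌋₊ (m - 1) : ℕ)) / m := by
    field_simp
  rw [this, abs_div, abs_of_pos hm']
  gcongr

theorem cellOf_mem_cells {m : ℕ} (hm : 0 < m) (x : Plane) : cellOf m x ∈ cells m := by
  simp only [cellOf, cells, Finset.mem_product, Finset.mem_range]
  omega

theorem dist_corner_cellOf_le {m : ℕ} (hm : 0 < m) {x : Plane} (hx : x ∈ unitSquare) :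
    dist x (corner m (cellOf m x)) ≤ 2 / m := by
  have h0 := abs_sub_floor_div_le hm (hx 0)
  have h1 := abs_sub_floor_div_le hm (hx 1)
  refine (dist_le_abs_add_abs _ _).trans ?_
  have : (2 : ℝ) / m = 1 / m + 1 / m := by ring
  rw [this]
  exact add_le_add (by simpa [corner, cellOf] using h0) (by simpa [corner, cellOf] using h1)

/-- The tour of the representatives has length `O(m)`. -/
theorem walkLength_representativeTour_le {n m : ℕ} (hm : 0 < m) (p : Fin n → Plane)
    (hp : ∀ v, p v ∈ unitSquare) (T₀ : List (Fin n)) (hT : IsRepresentativeTour m p T₀) :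
    walkLength p T₀ ≤ 7 * m := by
  have hm' : (0 : ℝ) < m := Nat.cast_pos.2 hm
  have hm1 : (1 : ℝ) ≤ m := by exact_mod_cast hm
  cases T₀ with
  | nil => simp [walkLength]
  | cons a l =>
    have hsub : ((a :: l).map fun v => cellOf m (p v)).Sublist (boustrophedon m) := by
      rw [hT]; exact List.filter_sublist
    have hlen : l.length + 1 ≤ m * m := by
      simpa [length_boustrophedon] using hsub.length_le
    have hlen' : (l.length : ℝ) + 1 ≤ m * m := by exact_mod_cast hlen
    rw [walkLength_cons]
    -- Moving the representatives to the corners of their cells costs at most `4 / m` on each of at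
    -- most `m * m` edges. The walk through corners shortcuts the full boustrophedon, which takes
    -- fewer than `m * m` steps of length at most `1 / m` and a return of at most `2`. Altogether
    -- this is `5 * m + 2 ≤ 7 * m`.
    have h1 := pathSum_dist_perturb p (fun v => corner m (cellOf m (p v))) (2 / m) a l a
      fun v _ => dist_corner_cellOf_le hm (hp v)
    have h2 : pathSum dist (corner m (cellOf m (p a))) (l.map fun v => corner m (cellOf m (p v)))
        (corner m (cellOf m (p a))) ≤ m + 2 := by
      set b := corner m (cellOf m (p a)) with hb
      obtain ⟨c, L, hcL⟩ : ∃ c L, boustrophedon m = c :: L := by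
        cases h : boustrophedon m with
        | nil => rw [h] at hsub; simp at hsub
        | cons c L => exact ⟨c, L, rfl⟩
      have h3 := pathSum_dist_le_of_isChain (1 / m) 2 (corner m c) (L.map (corner m)) b
        (by
          rw [← List.map_cons, ← hcL, List.isChain_map]
          exact isChain_boustrophedon hm)
        (by
          rw [← List.map_cons, ← hcL]
          intro x hx
          obtain ⟨d, hd, rfl⟩ := List.mem_map.1 hx
          rw [mem_boustrophedon] at hd
          have ha := cellOf_mem_cells hm (p a)
          simp only [cells, Finset.mem_product, Finset.mem_range] at hd ha
          refine (dist_corner_le m _ _).trans ((div_le_iff₀ hm').2 ?_)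
          have : ∀ s t : ℕ, s < m → t < m → |(s : ℝ) - t| ≤ m := fun s t hs ht => by
            have hs' : (s : ℝ) < m := by exact_mod_cast hs
            have ht' : (t : ℝ) < m := by exact_mod_cast ht
            have hs0 : (0 : ℝ) ≤ s := by positivity
            have ht0 : (0 : ℝ) ≤ t := by positivity
            rw [abs_le]; constructor <;> linarith
          linarith [this _ _ hd.1 ha.1, this _ _ hd.2 ha.2])
      have hL : (L.length : ℝ) + 1 = m * m := by
        have := length_boustrophedon m
        rw [hcL, List.length_cons] at this
        exact_mod_cast this
      have h4 : 1 / (m : ℝ) * (L.map (corner m)).length ≤ m := by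
        rw [List.length_map, one_div, inv_mul_le_iff₀ hm']; linarith
      refine (pathSum_dist_cons_sublist ?_ b).trans (h3.trans (by linarith))
      have := hsub.map (corner m)
      rwa [hcL, List.map_map, List.map_cons, List.map_cons] at this
    have h5 : 2 * (2 / (m : ℝ)) * (l.length + 1) ≤ 4 * m := by
      calc 2 * (2 / (m : ℝ)) * (l.length + 1) ≤ 2 * (2 / (m : ℝ)) * (m * m) := by gcongr
        _ = 4 * m := by field_simp; ring
    linarith

/-! ### Existence of a run and of an Eulerian walk -/

theorem exists_isOptimalTour {n : ℕ} (p : Fin n → Plane) (S : Finset (Fin n)) :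
    ∃ T, IsOptimalTour p S T := by
  classical
  have h0 : IsTour S S.toList := ⟨S.nodup_toList, fun v => Finset.mem_toList⟩
  have hperm : ∀ T, IsTour S T ↔ T ∈ S.toList.permutations.toFinset := fun T => by
    rw [List.mem_toFinset, List.mem_permutations]
    constructor
    · exact fun hT => (List.perm_ext_iff_of_nodup hT.1 h0.1).2 fun v => (hT.2 v).trans (h0.2 v).symm
    · exact fun h => ⟨h.nodup_iff.2 h0.1, fun v => h.mem_iff.trans (h0.2 v)⟩
  obtain ⟨T, hT, hmin⟩ := S.toList.permutations.toFinset.exists_min_image (walkLength p)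
    ⟨_, (hperm _).1 h0⟩
  exact ⟨T, (hperm T).2 hT, fun T' hT' => hmin T' ((hperm T').1 hT')⟩

section Euler

variable {ι α : Type*} (sub : ι → List α)

/-- Going around `sub c` at its first vertex, for each `c` in turn. -/
def detours (L : List ι) : List α := L.flatMap fun c => sub c ++ (sub c).take 1

/-- Going around `h :: t` and back to `h` inserts precisely the closed edges of `h :: t` at the
vertex `h`; the edges between consecutive first vertices are untouched. -/
theorem pathSum_detours (L : List ι) (hL : ∀ c ∈ L, sub c ≠ []) (a b : α) :
    pathSum (fun x y => ({s(x, y)} : Multiset (Sym2 α))) a (detours sub L) b =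
      pathSum (fun x y => {s(x, y)}) a (L.flatMap fun c => (sub c).take 1) b +
        (L.map fun c => closedEdges (sub c)).sum := by
  induction L generalizing a with
  | nil => simp [detours]
  | cons c L ih =>
    have ih := ih fun d hd => hL d (List.mem_cons_of_mem _ hd)
    obtain ⟨h, t, hc⟩ := List.exists_cons_of_ne_nil (hL c List.mem_cons_self)
    simp only [detours] at ih
    simp only [detours, List.flatMap_cons, hc, List.cons_append, List.take_succ_cons, List.take_zero,
      pathSum_cons, List.append_assoc, List.nil_append, pathSum_append, List.map_cons, List.sum_cons,
      closedEdges_cons, ih]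
    abel

theorem closedEdges_detours (L : List ι) (hL : ∀ c ∈ L, sub c ≠ []) :
    closedEdges (detours sub L) = closedEdges (L.flatMap fun c => (sub c).take 1) +
      (L.map fun c => closedEdges (sub c)).sum := by
  cases L with
  | nil => simp [detours, closedEdges_nil]
  | cons c L =>
    have h' := pathSum_detours sub L fun d hd => hL d (List.mem_cons_of_mem _ hd)
    obtain ⟨h, t, hc⟩ := List.exists_cons_of_ne_nil (hL c List.mem_cons_self)
    simp only [detours] at h'
    simp only [detours, List.flatMap_cons, hc, List.cons_append, List.take_succ_cons, List.take_zero,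
      closedEdges_cons, List.append_assoc, List.nil_append, pathSum_append, List.map_cons,
      List.sum_cons, h']
    abel

theorem flatMap_sublist_detours (L : List ι) : (L.flatMap sub).Sublist (detours sub L) := by
  induction L with
  | nil => simp [detours]
  | cons c L ih =>
    simp only [detours, List.flatMap_cons, List.append_assoc]
    exact (List.Sublist.refl _).append (ih.trans (List.sublist_append_right _ _))

end Euler

/-- Some run of the Stitch algorithm returns a tour. -/
theorem exists_isStitchOutput {n m : ℕ} (hm : 0 < m) (p : Fin n → Plane) :
    ∃ T, IsStitchOutput m p T := by
  classical
  choose sub hsub using fun c => exists_isOptimalTour p (pointsIn m p c)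
  have hmem : ∀ c v, v ∈ sub c ↔ cellOf m (p v) = c := fun c v => by
    rw [(hsub c).1.2, pointsIn, Finset.mem_filter, and_iff_right (Finset.mem_univ _)]
  have hne : ∀ c, (pointsIn m p c).Nonempty ↔ sub c ≠ [] := fun c => by
    rw [Ne, List.eq_nil_iff_forall_not_mem, not_forall_not]
    exact exists_congr fun v => ((hsub c).1.2 v).symm
  set L := (boustrophedon m).filter fun c => decide (pointsIn m p c).Nonempty with hL
  have hLne : ∀ c ∈ L, sub c ≠ [] := fun c hc =>
    (hne c).1 (of_decide_eq_true (List.mem_filter.1 hc).2)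
  have hnd : L.Nodup := (nodup_boustrophedon m).filter _
  -- The first vertex of each subtour is its representative. The walk follows `T₀` with a detour
  -- around each subtour, and dropping each return to a representative leaves the concatenated
  -- subtours.
  refine ⟨L.flatMap sub, sub, L.flatMap fun c => (sub c).take 1, detours sub L,
    fun c _ => ⟨(hsub c).1, fun _ => hsub c⟩, ?_, ?_, flatMap_sublist_detours sub L, ?_, fun v => ?_⟩
  · rw [IsRepresentativeTour, ← hL]
    clear_value L
    clear hL hnd
    induction L with
    | nil => rfl
    | cons c L ih =>
      obtain ⟨h, t, hc⟩ := List.exists_cons_of_ne_nil (hLne c List.mem_cons_self)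
      have hcell : cellOf m (p h) = c := (hmem c h).1 (by rw [hc]; exact List.mem_cons_self)
      rw [List.flatMap_cons, List.map_append, ih fun d hd => hLne d (List.mem_cons_of_mem _ hd), hc]
      simp [hcell]
  · rw [closedEdges_detours sub L hLne, ← List.sum_toFinset _ hnd]
    congr 1
    refine Finset.sum_subset (fun c hc => ?_) fun c hc hc' => ?_
    · exact mem_boustrophedon.1 (List.mem_filter.1 (List.mem_toFinset.1 hc)).1
    · have : sub c = [] := by
        by_contra h
        exact hc' (List.mem_toFinset.2 (List.mem_filter.2
          ⟨mem_boustrophedon.2 hc, decide_eq_true ((hne c).2 h)⟩))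
      rw [this, closedEdges_nil]
  · refine List.nodup_flatMap.2 ⟨fun c _ => (hsub c).1.1, hnd.imp fun {c d} hcd v hv hv' => hcd ?_⟩
    exact ((hmem c v).1 hv).symm.trans ((hmem d v).1 hv')
  · simp only [Finset.mem_univ, iff_true, List.mem_flatMap]
    have hv : v ∈ sub (cellOf m (p v)) := (hmem _ v).2 rfl
    exact ⟨_, List.mem_filter.2 ⟨mem_boustrophedon.2 (cellOf_mem_cells hm _),
      decide_eq_true ((hne _).2 (List.ne_nil_of_mem hv))⟩, hv⟩

/-! ### The deterministic bound on the excess -/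

/-- If no subsquare has too many points, then the output of the Stitch algorithm exceeds the optimum
by at most `O(m)`. -/
theorem walkLength_stitchOutput_le {n m : ℕ} (hn : 0 < n) (hm : 0 < m) (p : Fin n → Plane)
    (hp : ∀ v, p v ∈ unitSquare)
    (hcard : ∀ c ∈ cells m, ((pointsIn m p c).card : ℝ) ≤ 6 * Real.logb 2 n)
    {T T' : List (Fin n)} (hT : IsStitchOutput m p T) (hT' : IsTour Finset.univ T') :
    walkLength p T ≤ walkLength p T' + 15 * m := by
  obtain ⟨sub, T₀, w, hsub, hT₀, hw, hTw, -⟩ := hT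
  have h1 := walkLength_sublist p hTw
  have h2 := walkLength_representativeTour_le hm p hp T₀ hT₀
  have h3 := sum_walkLength_subtours_le hn hm p hp T' hT' sub fun c hc => (hsub c hc).2 (hcard c hc)
  have h4 : walkLength p w = walkLength p T₀ + ∑ c ∈ cells m, walkLength p (sub c) := by
    simp only [walkLength_eq_sum_closedEdges]
    rw [hw, Multiset.map_add, Multiset.sum_add, ← Multiset.coe_mapAddMonoidHom, map_sum,
      ← Multiset.coe_sumAddMonoidHom, map_sum]
  linarith

theorem stitchSucceeds_of {n m : ℕ} {ε : ℝ} (hn : 0 < n) (hm : 0 < m) (p : Fin n → Plane)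
    (hp : ∀ v, p v ∈ unitSquare)
    (hcard : ∀ c ∈ cells m, ((pointsIn m p c).card : ℝ) ≤ 6 * Real.logb 2 n)
    (hopt : ∀ T, IsTour Finset.univ T → 15 * m < ε * walkLength p T) : StitchSucceeds m ε p := by
  refine ⟨exists_isStitchOutput hm p, fun T T' hT hT' => ?_⟩
  have h1 := walkLength_stitchOutput_le hn hm p hp hcard hT hT'.1
  have h2 := hopt T' hT'.1
  linarith

/-! ### A lower bound for the length of tours -/

/-- A tour is long if few pairs of points are close to each other. -/
theorem le_walkLength {n : ℕ} (hn : 2 ≤ n) (p : Fin n → Plane) (r : ℝ) (hr : 0 ≤ r)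
    (T : List (Fin n)) (hT : IsTour Finset.univ T) :
    r * (n - (Finset.univ.filter fun e : Fin n × Fin n =>
      e.1 ≠ e.2 ∧ dist (p e.1) (p e.2) < r).card) ≤ walkLength p T := by
  classical
  -- Each edge is charged to its start `a`. The charge is `r` if no other point is within `r` of `a`
  -- and at most `0` otherwise, so it never exceeds the length of an edge to a different vertex; the
  -- charges sum to the left-hand side.
  set f : Fin n → ℝ := fun a =>
    r * (1 - (Finset.univ.filter fun b : Fin n => a ≠ b ∧ dist (p a) (p b) < r).card) with hf
  have key : ∀ a b, a ≠ b → f a ≤ dist (p a) (p b) := fun a b hab => by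
    by_cases h : dist (p a) (p b) < r
    · have h1 : 1 ≤ (Finset.univ.filter fun b : Fin n => a ≠ b ∧ dist (p a) (p b) < r).card :=
        Finset.card_pos.2 ⟨b, by simp [hab, h]⟩
      have h2 : (1 : ℝ) ≤ (Finset.univ.filter fun b : Fin n => a ≠ b ∧ dist (p a) (p b) < r).card :=
        by exact_mod_cast h1
      exact (mul_nonpos_of_nonneg_of_nonpos hr (by linarith)).trans dist_nonneg
    · exact (mul_le_of_le_one_right hr (by simp)).trans (not_lt.1 h)
  have hpath : ∀ (l : List (Fin n)) (a b : Fin n), (a :: l).IsChain (· ≠ ·) →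
      (∀ x ∈ (a :: l).getLast?, x ≠ b) →
      ((a :: l).map f).sum ≤ pathSum (fun x y => dist (p x) (p y)) a l b := by
    intro l
    induction l with
    | nil => intro a b _ h; simpa using key a b (h a rfl)
    | cons x l ih =>
      intro a b h h'
      rw [List.isChain_cons_cons] at h
      have h1 := ih x b h.2 (by simpa using h')
      have h2 := key a x h.1
      rw [List.map_cons, List.sum_cons, pathSum_cons]
      linarith
  have hsum : (T.map f).sum = r * (n - (Finset.univ.filter fun e : Fin n × Fin n =>
      e.1 ≠ e.2 ∧ dist (p e.1) (p e.2) < r).card) := by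
    have hTu : T.toFinset = Finset.univ := by
      ext v; rw [List.mem_toFinset, hT.2]
    rw [← List.sum_toFinset _ hT.1, hTu, ← Finset.mul_sum, Finset.sum_sub_distrib]
    congr 2
    · simp
    · rw [Finset.card_filter, ← Finset.univ_product_univ, Finset.sum_product]
      push_cast
      exact Finset.sum_congr rfl fun a _ => by rw [Finset.card_filter]; push_cast; rfl
  rw [← hsum]
  cases T with
  | nil => simp [walkLength]
  | cons a l =>
    rw [walkLength_cons, pathSum_map]
    refine hpath l a a (List.Pairwise.isChain hT.1) fun x hx => ?_
    rintro rfl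
    -- Here `2 ≤ n` is needed: with a single point the closing edge is a loop of length `0`.
    have hl : l ≠ [] := by
      rintro rfl
      have h1 := (hT.2 ⟨0, by omega⟩).2 (Finset.mem_univ _)
      have h2 := (hT.2 ⟨1, by omega⟩).2 (Finset.mem_univ _)
      rw [List.mem_singleton] at h1 h2
      simpa using congrArg Fin.val (h1.trans h2.symm)
    rw [List.getLast?_cons, List.getLast?_eq_some_getLast hl] at hx
    simp at hx
    have := List.getLast_mem hl
    rw [hx] at this
    exact (List.nodup_cons.1 hT.1).1 this

end Stitch

/-! ### Probability estimates for uniform points -/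

open MeasureTheory ProbabilityTheory Filter
open scoped ENNReal

namespace Stitch

theorem volume_box (lo hi : Fin 2 → ℝ) :
    volume (box lo hi) = ∏ k, ENNReal.ofReal (hi k - lo k) := by
  have : box lo hi = WithLp.ofLp ⁻¹' Set.Icc lo hi := by
    ext x
    simp only [box, Set.mem_ofPred_eq, Set.mem_preimage, Set.mem_Icc, Pi.le_def]
    exact forall_and
  rw [this, (PiLp.volume_preserving_ofLp (Fin 2)).measure_preimage measurableSet_Icc.nullMeasurableSet,
    Real.volume_Icc_pi]

theorem volume_unitSquare : volume unitSquare = 1 := by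
  have : unitSquare = box 0 1 := rfl
  rw [this, volume_box]; simp

theorem measurableSet_unitSquare : MeasurableSet unitSquare := by
  have : unitSquare = ⋂ i, (fun x : Plane => x i) ⁻¹' Set.Icc 0 1 := by
    ext x; simp [unitSquare]
  rw [this]
  exact MeasurableSet.iInter fun i => (by fun_prop : Measurable fun x : Plane => x i) measurableSet_Icc

instance : IsProbabilityMeasure uniformSquare :=
  cond_isProbabilityMeasure_of_finite (by simp [volume_unitSquare]) (by simp [volume_unitSquare])

instance (n : ℕ) : IsProbabilityMeasure (uniformPoints n) := by
  rw [uniformPoints]; infer_instance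

theorem uniformSquare_apply (s : Set Plane) : uniformSquare s = volume (unitSquare ∩ s) := by
  rw [uniformSquare, cond_apply measurableSet_unitSquare, volume_unitSquare, inv_one, one_mul]

theorem measurable_cellOf (m : ℕ) : Measurable (cellOf m) := by
  unfold cellOf
  fun_prop

theorem uniformSquare_cell_le {m : ℕ} (hm : 0 < m) (c : ℕ × ℕ) :
    uniformSquare {x | cellOf m x = c} ≤ ENNReal.ofReal (1 / m ^ 2) := by
  have hm' : (0 : ℝ) < m := Nat.cast_pos.2 hm
  have key : ∀ t : ℝ, t ∈ Set.Icc (0 : ℝ) 1 → ∀ k, min ⌊(m : ℝ) * t⌋₊ (m - 1) = k →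
      (k : ℝ) / m ≤ t ∧ t ≤ (k + 1) / m := by
    rintro t ⟨h0, h1⟩ k rfl
    rw [div_le_iff₀' hm', le_div_iff₀' hm']
    constructor
    · exact (Nat.cast_le.2 (min_le_left _ _)).trans (Nat.floor_le (by positivity))
    · rcases min_cases ⌊(m : ℝ) * t⌋₊ (m - 1) with ⟨h, -⟩ | ⟨h, -⟩
      · rw [h]; exact (Nat.lt_floor_add_one _).le
      · rw [h, Nat.cast_sub hm, Nat.cast_one, sub_add_cancel]; nlinarith
  rw [uniformSquare_apply]
  refine (measure_mono (t := box ![(c.1 : ℝ) / m, (c.2 : ℝ) / m]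
    ![((c.1 : ℝ) + 1) / m, ((c.2 : ℝ) + 1) / m]) ?_).trans ?_
  · rintro x ⟨hx, hc⟩ k
    have h1 := key _ (hx 0) c.1 (congrArg Prod.fst hc)
    have h2 := key _ (hx 1) c.2 (congrArg Prod.snd hc)
    fin_cases k
    exacts [h1, h2]
  · rw [volume_box, Fin.prod_univ_two]
    simp only [Matrix.cons_val_zero, Matrix.cons_val_one]
    rw [← sub_div, ← sub_div, add_sub_cancel_left, add_sub_cancel_left,
      ← ENNReal.ofReal_mul (by positivity)]
    exact ENNReal.ofReal_le_ofReal (by rw [div_mul_div_comm, one_mul, sq])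

/-- Chernoff's bound for the number of points in a subsquare. -/
theorem uniformPoints_crowded_le {n m : ℕ} (hn : 0 < n) (hm : 0 < m) (c : ℕ × ℕ) :
    uniformPoints n {p | 6 * Real.logb 2 n < ((pointsIn m p c).card : ℝ)} ≤
      ENNReal.ofReal (Real.exp (n / m ^ 2) / n ^ 6) := by
  classical
  have hn' : (0 : ℝ) < n := Nat.cast_pos.2 hn
  set A : Set Plane := {x | cellOf m x = c} with hA
  have hAm : MeasurableSet A := measurable_cellOf m (measurableSet_singleton c)
  -- The exponential moment with base `2`: the product of the `F (p v)` is `2` to the number of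
  -- points in the cell, and the threshold `6 log₂ n` becomes `n ^ 6`. By independence its mean is
  -- at most `(1 + 1 / m ^ 2) ^ n ≤ exp (n / m ^ 2)`.
  set F : Plane → ℝ≥0∞ := fun x => 1 + A.indicator 1 x with hF
  have hFm : Measurable F :=
    (measurable_const (a := (1 : ℝ≥0∞))).fun_add (measurable_one.indicator hAm)
  have hFint : ∫⁻ x, F x ∂uniformSquare ≤ ENNReal.ofReal (1 + 1 / m ^ 2) := by
    rw [lintegral_add_left measurable_const, lintegral_indicator_one hAm, lintegral_const,
      measure_univ, mul_one, ENNReal.ofReal_add zero_le_one (by positivity), ENNReal.ofReal_one]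
    exact add_le_add_right (uniformSquare_cell_le hm c) _
  have hprod : ∫⁻ p, ∏ v, F (p v) ∂uniformPoints n ≤ ENNReal.ofReal (Real.exp (n / m ^ 2)) := by
    have hind : iIndepFun (fun (v : Fin n) (p : Fin n → Plane) => F (p v)) (uniformPoints n) :=
      iIndepFun_pi fun _ => hFm.aemeasurable
    rw [lintegral_prod_eq_prod_lintegral_of_indepFun Finset.univ _ hind
      fun v => hFm.comp (measurable_pi_apply v)]
    have h1 : ∀ v : Fin n, ∫⁻ p, F (p v) ∂uniformPoints n = ∫⁻ x, F x ∂uniformSquare := fun v =>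
      (measurePreserving_eval (fun _ : Fin n => uniformSquare) v).lintegral_comp hFm
    simp only [h1, Finset.prod_const, Finset.card_univ, Fintype.card_fin]
    refine (pow_le_pow_left' hFint n).trans ?_
    rw [← ENNReal.ofReal_pow (by positivity)]
    refine ENNReal.ofReal_le_ofReal ?_
    have h2 : 1 + 1 / (m : ℝ) ^ 2 ≤ Real.exp (1 / m ^ 2) := by
      rw [add_comm]; exact Real.add_one_le_exp _
    refine (pow_le_pow_left₀ (by positivity) h2 n).trans_eq ?_
    rw [← Real.exp_nat_mul, mul_one_div]
  have hsub : {p : Fin n → Plane | 6 * Real.logb 2 n < ((pointsIn m p c).card : ℝ)} ⊆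
      {p | ENNReal.ofReal (n ^ 6) ≤ ∏ v, F (p v)} := fun p hp => by
    have h1 : ∏ v, F (p v) = ENNReal.ofReal (2 ^ (pointsIn m p c).card) := by
      have : ∀ v, F (p v) = if cellOf m (p v) = c then 2 else 1 := fun v => by
        by_cases h : cellOf m (p v) = c
        · have h' : p v ∈ A := h
          simp only [hF, Set.indicator_of_mem h', h, if_true, Pi.one_apply]
          norm_num
        · have h' : p v ∉ A := h
          simp [hF, Set.indicator_of_notMem h', h]
      simp only [this]
      rw [← Finset.prod_filter, Finset.prod_const, ENNReal.ofReal_pow zero_le_two,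
        ENNReal.ofReal_ofNat]
      rfl
    simp only [Set.mem_ofPred_eq] at hp ⊢
    rw [h1]
    refine ENNReal.ofReal_le_ofReal ?_
    have h2 : (n : ℝ) ^ 6 = 2 ^ (6 * Real.logb 2 n) := by
      rw [mul_comm, Real.rpow_mul zero_le_two, Real.rpow_logb zero_lt_two (by norm_num) hn']
      norm_cast
    rw [h2, ← Real.rpow_natCast]
    exact Real.rpow_le_rpow_of_exponent_le one_le_two hp.le
  refine (measure_mono hsub).trans ?_
  have hmeas : Measurable fun p : Fin n → Plane => ∏ v, F (p v) :=
    Finset.measurable_prod _ fun v _ => hFm.comp (measurable_pi_apply v)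
  have hmarkov := (mul_meas_ge_le_lintegral (μ := uniformPoints n) hmeas
    (ENNReal.ofReal (n ^ 6))).trans hprod
  have hpos : 0 < (n : ℝ) ^ 6 := by positivity
  rw [ENNReal.ofReal_div_of_pos hpos, ENNReal.le_div_iff_mul_le
    (Or.inl (ENNReal.ofReal_pos.2 hpos).ne') (Or.inl ENNReal.ofReal_ne_top), mul_comm]
  exact hmarkov

/-- By independence one may fix the first point; the second must then lie in a disc of area `π r²`.
-/
theorem uniformPoints_close_le {n : ℕ} {a b : Fin n} (hab : a ≠ b) (r : ℝ) :
    uniformPoints n {p | dist (p a) (p b) < r} ≤ ENNReal.ofReal r ^ 2 * ENNReal.ofReal Real.pi := by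
  have hind : iIndepFun (fun (v : Fin n) (p : Fin n → Plane) => p v) (uniformPoints n) :=
    iIndepFun_pi (X := fun _ x => x) fun _ => measurable_id.aemeasurable
  have hpair := (indepFun_iff_map_prod_eq_prod_map_map (measurable_pi_apply a).aemeasurable
    (measurable_pi_apply b).aemeasurable).1 (hind.indepFun hab)
  have hmap : ∀ v : Fin n, (uniformPoints n).map (fun p => p v) = uniformSquare := fun v =>
    (measurePreserving_eval (fun _ : Fin n => uniformSquare) v).map_eq
  rw [hmap, hmap] at hpair
  have hs : MeasurableSet {z : Plane × Plane | dist z.1 z.2 < r} :=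
    measurableSet_lt (by fun_prop) measurable_const
  have h1 : uniformPoints n {p | dist (p a) (p b) < r} =
      (uniformSquare.prod uniformSquare) {z | dist z.1 z.2 < r} := by
    rw [← hpair, Measure.map_apply (by fun_prop) hs]; rfl
  rw [h1, Measure.prod_apply hs]
  calc _ ≤ ∫⁻ _, ENNReal.ofReal r ^ 2 * ENNReal.ofReal Real.pi ∂uniformSquare := by
        refine lintegral_mono fun x => ?_
        rw [uniformSquare_apply, ← EuclideanSpace.volume_ball_fin_two x r]
        refine measure_mono fun y hy => ?_
        rw [Metric.mem_ball, dist_comm]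
        exact hy.2
    _ = _ := by rw [lintegral_const, measure_univ, mul_one]

/-- With high probability at most `n / 2` (ordered) pairs of points are within distance `r`, if
`n * r ^ 2` is small. -/
theorem uniformPoints_many_close_le {n : ℕ} (hn : 0 < n) {r : ℝ} (hr : 0 ≤ r) :
    uniformPoints n {p | (n : ℝ) / 2 ≤ (Finset.univ.filter fun e : Fin n × Fin n =>
      e.1 ≠ e.2 ∧ dist (p e.1) (p e.2) < r).card} ≤ ENNReal.ofReal (2 * Real.pi * n * r ^ 2) := by
  classical
  have hn' : (0 : ℝ) < n := Nat.cast_pos.2 hn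
  set P : Finset (Fin n × Fin n) := Finset.univ.filter fun e => e.1 ≠ e.2 with hP
  set A : Fin n × Fin n → Set (Fin n → Plane) := fun e => {p | dist (p e.1) (p e.2) < r} with hA
  have hAm : ∀ e, MeasurableSet (A e) := fun e => measurableSet_lt (by fun_prop) measurable_const
  set f : (Fin n → Plane) → ℝ≥0∞ := fun p => ∑ e ∈ P, (A e).indicator 1 p with hf
  have hfm : Measurable f := Finset.measurable_sum _ fun e _ => measurable_one.indicator (hAm e)
  have hint : ∫⁻ p, f p ∂uniformPoints n ≤ ENNReal.ofReal (n ^ 2 * (r ^ 2 * Real.pi)) := by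
    rw [lintegral_finsetSum _ fun e _ => measurable_one.indicator (hAm e)]
    calc _ ≤ ∑ e ∈ P, ENNReal.ofReal (r ^ 2 * Real.pi) := by
          refine Finset.sum_le_sum fun e he => ?_
          rw [lintegral_indicator_one (hAm e), ENNReal.ofReal_mul (by positivity),
            ENNReal.ofReal_pow hr]
          exact uniformPoints_close_le (Finset.mem_filter.1 he).2 r
      _ ≤ _ := by
          rw [Finset.sum_const, nsmul_eq_mul,
            ENNReal.ofReal_mul (by positivity : (0 : ℝ) ≤ (n : ℝ) ^ 2)]
          gcongr
          rw [ENNReal.ofReal_pow hn'.le, ENNReal.ofReal_natCast]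
          have : P.card ≤ n ^ 2 := (Finset.card_filter_le _ _).trans_eq (by simp [sq])
          exact_mod_cast this
  have hfcard : ∀ p, f p = ENNReal.ofReal (Finset.univ.filter fun e : Fin n × Fin n =>
      e.1 ≠ e.2 ∧ dist (p e.1) (p e.2) < r).card := fun p => by
    rw [ENNReal.ofReal_natCast, ← Finset.filter_filter, Finset.card_filter]
    push_cast
    refine Finset.sum_congr rfl fun e _ => ?_
    rw [Set.indicator_apply]
    rfl
  have hsub : {p : Fin n → Plane | (n : ℝ) / 2 ≤ (Finset.univ.filter fun e : Fin n × Fin n =>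
      e.1 ≠ e.2 ∧ dist (p e.1) (p e.2) < r).card} ⊆ {p | ENNReal.ofReal (n / 2) ≤ f p} := by
    intro p hp
    rw [Set.mem_ofPred_eq, hfcard]
    exact ENNReal.ofReal_le_ofReal hp
  refine (measure_mono hsub).trans ?_
  -- Markov's inequality for the number of ordered close pairs; no independence between different
  -- pairs is needed.
  have hmarkov := (mul_meas_ge_le_lintegral (μ := uniformPoints n) hfm
    (ENNReal.ofReal (n / 2))).trans hint
  have hpos : 0 < (n : ℝ) / 2 := by positivity
  have e : 2 * Real.pi * n * r ^ 2 = n ^ 2 * (r ^ 2 * Real.pi) / (n / 2) := by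
    field_simp
  rw [e, ENNReal.ofReal_div_of_pos hpos, ENNReal.le_div_iff_mul_le
    (Or.inl (ENNReal.ofReal_pos.2 hpos).ne') (Or.inl ENNReal.ofReal_ne_top), mul_comm]
  exact hmarkov

theorem uniformPoints_outside (n : ℕ) : uniformPoints n {p | ∃ v, p v ∉ unitSquare} = 0 := by
  have : {p : Fin n → Plane | ∃ v, p v ∉ unitSquare} =
      ⋃ v, (fun p => p v) ⁻¹' unitSquareᶜ := by
    ext p; simp
  rw [this, measure_iUnion_null_iff]
  intro v
  have h := (measurePreserving_eval (fun _ : Fin n => uniformSquare) v).measure_preimage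
    measurableSet_unitSquare.compl.nullMeasurableSet
  refine h.trans ?_
  rw [uniformSquare_apply, Set.inter_compl_self, measure_empty]

/-- A bound for the probability that the Stitch algorithm fails. -/
theorem uniformPoints_not_stitchSucceeds_le {n m : ℕ} (hn : 2 ≤ n) (hm : 0 < m) {ε : ℝ}
    (hε : 0 < ε) :
    uniformPoints n {p | ¬ StitchSucceeds m ε p} ≤
      ENNReal.ofReal (m ^ 2 * (Real.exp (n / m ^ 2) / n ^ 6) +
        1800 * Real.pi / ε ^ 2 * (m ^ 2 / n)) := by
  have hn0 : 0 < n := by omega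
  have hn' : (0 : ℝ) < n := Nat.cast_pos.2 hn0
  have hm' : (0 : ℝ) < m := Nat.cast_pos.2 hm
  -- Chosen so that `ε * (r * n / 2) = 15 * m`, the excess to be beaten; then `2 π n r²` is the
  -- second term of the bound.
  set r : ℝ := 30 / ε * (m / n) with hr
  have hr0 : 0 < r := by positivity
  have hsub : {p : Fin n → Plane | ¬ StitchSucceeds m ε p} ⊆
      {p | ∃ v, p v ∉ unitSquare} ∪
      ((⋃ c ∈ cells m, {p | 6 * Real.logb 2 n < ((pointsIn m p c).card : ℝ)}) ∪
      {p | (n : ℝ) / 2 ≤ (Finset.univ.filter fun e : Fin n × Fin n =>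
        e.1 ≠ e.2 ∧ dist (p e.1) (p e.2) < r).card}) := by
    intro p hp
    by_contra hcon
    simp only [Set.mem_union, Set.mem_ofPred_eq, Set.mem_iUnion, not_or, not_exists, not_not, not_lt,
      not_le] at hcon
    obtain ⟨h1, h2, h3⟩ := hcon
    refine hp (stitchSucceeds_of hn0 hm p h1 h2 fun T hT => ?_)
    have h4 := le_walkLength hn p r hr0.le T hT
    have h5 : r * (n / 2) < walkLength p T :=
      (mul_lt_mul_of_pos_left (by linarith) hr0).trans_le h4
    have h6 : ε * (r * (n / 2)) = 15 * m := by rw [hr]; field_simp; norm_num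
    rw [← h6]
    exact mul_lt_mul_of_pos_left h5 hε
  refine (measure_mono hsub).trans ((measure_union_le _ _).trans ?_)
  rw [uniformPoints_outside, zero_add, ENNReal.ofReal_add (by positivity) (by positivity)]
  refine (measure_union_le _ _).trans (add_le_add ?_ ?_)
  · refine (measure_biUnion_finset_le _ _).trans
      ((Finset.sum_le_sum fun c _ => uniformPoints_crowded_le hn0 hm c).trans_eq ?_)
    rw [Finset.sum_const, cells, Finset.card_product, Finset.card_range, nsmul_eq_mul,
      ENNReal.ofReal_mul (by positivity), ENNReal.ofReal_pow hm'.le, ENNReal.ofReal_natCast]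
    rw [Nat.cast_mul, sq (m : ℝ≥0∞)]
  · refine (uniformPoints_many_close_le hn0 hr0.le).trans_eq ?_
    congr 1
    rw [hr]
    field_simp
    norm_num

end Stitch

/-! ### Asymptotics for the prescribed grid size -/

theorem theoremt (ε : ℝ) (hε : 0 < ε) (m : ℕ → ℕ)
    (hm : ∀ n : ℕ, m n = ⌊Real.sqrt ((n : ℝ) / Real.log n)⌋₊ ∨
      m n = ⌈Real.sqrt ((n : ℝ) / Real.log n)⌉₊) :
    Filter.Tendsto
      (fun n : ℕ => Stitch.uniformPoints n {p | ¬ Stitch.StitchSucceeds (m n) ε p})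
      Filter.atTop (nhds 0) := by
  have hlog : Tendsto (fun n : ℕ => Real.log n) atTop atTop :=
    Real.tendsto_log_atTop.comp tendsto_natCast_atTop_atTop
  have hratio : ∀ᶠ n : ℕ in atTop, 16 * Real.log n ≤ n := by
    have h := (Real.isLittleO_log_id_atTop.comp_tendsto tendsto_natCast_atTop_atTop).def
      (show (0 : ℝ) < 1 / 16 by norm_num)
    filter_upwards [h, eventually_ge_atTop 1] with n hn h1
    have h2 : (1 : ℝ) ≤ n := by exact_mod_cast h1
    simp only [Function.comp, id, Real.norm_natCast] at hn
    rw [Real.norm_of_nonneg (Real.log_nonneg h2)] at hn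
    linarith
  have hlim : Tendsto (fun n : ℕ => ENNReal.ofReal
      (1 / n + 7200 * Real.pi / ε ^ 2 * (Real.log n)⁻¹)) atTop (nhds 0) := by
    rw [← ENNReal.ofReal_zero]
    refine ENNReal.tendsto_ofReal ?_
    have h1 := (tendsto_one_div_atTop_nhds_zero_nat (𝕜 := ℝ)).add
      ((tendsto_inv_atTop_zero.comp hlog).const_mul (7200 * Real.pi / ε ^ 2))
    simpa using h1
  refine tendsto_of_tendsto_of_tendsto_of_le_of_le' tendsto_const_nhds hlim
    (Eventually.of_forall fun _ => zero_le) ?_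
  filter_upwards [hratio, hlog.eventually_ge_atTop 4, eventually_ge_atTop 2] with n h16 hl hn
  have hn' : (0 : ℝ) < n := by positivity
  have hn1 : (1 : ℝ) ≤ n := by exact_mod_cast (by omega : 1 ≤ n)
  have hl0 : 0 < Real.log n := by linarith
  set x := Real.sqrt ((n : ℝ) / Real.log n) with hx
  have hx2 : x ^ 2 = n / Real.log n := Real.sq_sqrt (by positivity)
  -- With `x ≥ 4`, rounding in either direction is harmless: `x² ≤ 2 (x - 1)²` and `(x + 1)² ≤ 4
  -- x²`.
  have hx4 : 4 ≤ x := Real.le_sqrt_of_sq_le ((le_div_iff₀ hl0).2 (by linarith))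
  have hmx : x - 1 ≤ m n ∧ (m n : ℝ) ≤ x + 1 := by
    rcases hm n with h | h <;> rw [h]
    · exact ⟨(Nat.sub_one_lt_floor x).le, (Nat.floor_le (by linarith)).trans (by linarith)⟩
    · exact ⟨by linarith [Nat.le_ceil x], (Nat.ceil_lt_add_one (by linarith)).le⟩
  have hm0 : (0 : ℝ) < m n := by linarith [hmx.1]
  have hlow : (n : ℝ) / m n ^ 2 ≤ 2 * Real.log n := by
    have h1 : x ^ 2 ≤ 2 * (m n : ℝ) ^ 2 := by nlinarith [hmx.1]
    rw [hx2, div_le_iff₀ hl0] at h1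
    rw [div_le_iff₀ (by positivity)]
    linarith
  have hupp : (m n : ℝ) ^ 2 / n ≤ 4 * (Real.log n)⁻¹ := by
    have h1 : (m n : ℝ) ^ 2 ≤ 4 * x ^ 2 := by nlinarith [hmx.2]
    rw [div_le_iff₀ hn']
    calc (m n : ℝ) ^ 2 ≤ 4 * (n / Real.log n) := hx2 ▸ h1
      _ = _ := by ring
  have hmn : (m n : ℝ) ^ 2 ≤ n := by
    have h1 : 4 * (Real.log n)⁻¹ ≤ 1 := by
      rw [← div_eq_mul_inv]; exact (div_le_one hl0).2 hl
    exact (div_le_one hn').1 (hupp.trans h1)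
  refine (Stitch.uniformPoints_not_stitchSucceeds_le hn (by exact_mod_cast hm0) hε).trans
    (ENNReal.ofReal_le_ofReal (add_le_add ?_ ?_))
  -- The union bound over `m² ≤ n` cells, each crowded with probability at most `n² / n⁶`, leaves
  -- `n⁻³`.
  · have hexp : Real.exp (n / m n ^ 2) ≤ (n : ℝ) ^ 2 := by
      refine (Real.exp_le_exp.2 hlow).trans_eq ?_
      have := Real.exp_nat_mul (Real.log n) 2
      rw [Real.exp_log hn'] at this
      exact_mod_cast this
    calc (m n : ℝ) ^ 2 * (Real.exp (n / m n ^ 2) / n ^ 6) ≤ (n : ℝ) * ((n : ℝ) ^ 2 / n ^ 6) := by gcongr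
      _ = 1 / (n : ℝ) ^ 3 := by field_simp
      _ ≤ 1 / (n : ℝ) := one_div_le_one_div_of_le hn' (le_self_pow₀ hn1 (by norm_num))
  · calc 1800 * Real.pi / ε ^ 2 * ((m n : ℝ) ^ 2 / n)
        ≤ 1800 * Real.pi / ε ^ 2 * (4 * (Real.log n)⁻¹) := by gcongr
      _ = _ := by ring
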